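/- Let $\alpha,\beta,\gamma,\lambda,\mu>0$ with $\alpha+\beta+\gamma=1$, and set $$c_1=\frac{\alpha+\beta}{1+\lambda(\alpha+\gamma)},\qquad c_2=\frac{\beta+\gamma}{1+\mu(\alpha+\gamma)},\qquad a=\frac{c_2}{c_1}.$$ Assume $c_1\neq c_2$. **The model.** Start from a finite directed graph $G(n_0)$ (loops and multiple edges allowed) with $n_0\ge 0$ edges and at least one node. Given $G(n)$, which has $n$ edges and $N(n)$ nodes, $G(n+1)$ is obtained as follows: with probability $\alpha$ a new node $w$ and an edge $w\to v$ are added, where the existing node $v$ is chosen with probability $\frac{D_{in}(v)+\lambda}{n+\lambda N(n)}$; with probability $\beta$ an edge $v\to w$ between existing nodes is added, where $v$ and $w$ are chosen independently with probabilities $\frac{D_{out}(v)+\mu}{n+\mu N(n)}$ and $\frac{D_{in}(w)+\lambda}{n+\lambda N(n)}$; with probability $\gamma$ a new node $w$ and an edge $v\to w$ are added, where the existing node $v$ is chosen with probability $\frac{D_{out}(v)+\mu}{n+\mu N(n)}$. Let $N_{ij}(n)$ be the number of nodes of $G(n)$ with in-degree $i$ and out-degree $j$. **Definitions.** A measurable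 $h:(0,\infty)\to(0,\infty)$ is in $RV_\rho$ if $h(tx)/h(t)\to x^\rho$ as $t\to\infty$ for all $x>0$. Let $b_i\in RV_{\beta_i}$ with $\beta_i>0$, $i=1,2$. A function $k:\{0,1,2,\dots\}^2\to[0,\infty)$ is regularly varying with scaling functions $b_1,b_2$ and limit function $L$ if for some $\rho\in\mathbb R$, $h\in RV_\rho$ one has $k([b_1(n)x],[b_2(n)y])/h(n)\to L(x,y)>0$ as $n\to\infty$ over the integers, for all $x,y>0$. A measurable function $g:[0,\infty)^2\to[0,\infty)$ is regularly varying with scaling functions $b_1,b_2$ and limit function $L$ if for some $\rho\in\mathbb R$, $h\in RV_\rho$ one has $g(b_1(t)x,b_2(t)y)/h(t)\to L(x,y)>0$ as $t\to\infty$ over the reals, for all $x,y>0$. Such a $k$ is embeddable if $g(x,y)=k([x],[y])$ is regularly varying in this sense with the same scaling functions and limit function. **Statement.** There is a probability mass function $p(i,j)$, $i,j=0,1,2,\dots$, not depending on the initial graph, such that $N_{ij}(n)/N(n)\to p(i,j)$ almost surely for all $i,j$, and such that: 1. For all $x,y>0$, with convergent integrals, $$\lim_{n\to\infty}\frac{p([n^{c_1}x],[n^{c_2}y])}{n^{-(1+c_1+c_2)}}=L(x,y),$$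 where $$L(x,y)=\frac{\gamma}{\alpha+\gamma}\,\frac{x^{\lambda}y^{\mu-1}}{c_1\Gamma(\lambda+1)\Gamma(\mu)}\int_0^\infty z^{-(2+1/c_1+\lambda+a\mu)}e^{-\left(\frac{x}{z}+\frac{y}{z^{a}}\right)}dz+\frac{\alpha}{\alpha+\gamma}\,\frac{x^{\lambda-1}y^{\mu}}{c_1\Gamma(\lambda)\Gamma(\mu+1)}\int_0^\infty z^{-(1+a+1/c_1+\lambda+a\mu)}e^{-\left(\frac{x}{z}+\frac{y}{z^{a}}\right)}dz .$$ 2. $p$ is regularly varying with scaling functions $t^{c_1},t^{c_2}$ and limit function $L$, and it is embeddable. 3. As $t\to\infty$ over the reals, $t^{1+c_1+c_2}\,p([t^{c_1}x],[t^{c_2}y])\to L(x,y)$ uniformly on every compact set $K\subset[0,\infty)^2\setminus\{(0,0)\}$ such that $x>0$ on $K$ if $\lambda<1$, and $y>0$ on $K$ if $\mu<1$ (with $0^0=1$). In particular, the convergence is uniform on every compact subset of $\mathcal E_0\cap(0,\infty)^2$, and, if $\lambda\ge1$ and $\mu\ge1$, on all of $\mathcal E_0$, where $\mathcal E_0=\{(x,y)\in[0,\infty)^2:\|(x^{1/c_1},y^{1/c_2})\|=1\}$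 for an arbitrary norm $\|\cdot\|$ on $\mathbb R^2$. -/

import Mathlib

open Filter Topology MeasureTheory Set

noncomputable section

/-! ### Regular variation and embeddability -/

/-- `h` maps `(0,∞)` to `(0,∞)`, is measurable there, and `h (t x) / h t → x ^ ρ` as `t → ∞`
for every `x > 0`. -/
structure IsRegVar (ρ : ℝ) (h : ℝ → ℝ) : Prop where
  pos : ∀ t, 0 < t → 0 < h t
  measurable : Measurable fun t : Ioi (0 : ℝ) => h t
  tendsto : ∀ x, 0 < x → Tendsto (fun t : ℝ => h (t * x) / h t) atTop (𝓝 (x ^ ρ))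

/-- A nonnegative doubly indexed function `k` is regularly varying with scaling functions
`b₁, b₂` and limit function `L` (along integers `n → ∞`). -/
def IsRegVarDiscrete (k : ℕ → ℕ → ℝ) (b₁ b₂ : ℝ → ℝ) (L : ℝ → ℝ → ℝ) : Prop :=
  (∀ i j, 0 ≤ k i j) ∧
  (∃ β₁, 0 < β₁ ∧ IsRegVar β₁ b₁) ∧ (∃ β₂, 0 < β₂ ∧ IsRegVar β₂ b₂) ∧
  ∃ (ρ : ℝ) (h : ℝ → ℝ), IsRegVar ρ h ∧ ∀ x y, 0 < x → 0 < y → 0 < L x y ∧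
    Tendsto (fun n : ℕ => k ⌊b₁ n * x⌋₊ ⌊b₂ n * y⌋₊ / h n) atTop (𝓝 (L x y))

/-- A measurable function `f : [0,∞)² → [0,∞)` is regularly varying with scaling functions
`b₁, b₂` and limit function `L` (along reals `t → ∞`). -/
def IsRegVarBivariate (f : ℝ → ℝ → ℝ) (b₁ b₂ : ℝ → ℝ) (L : ℝ → ℝ → ℝ) : Prop :=
  (∀ x y, 0 ≤ x → 0 ≤ y → 0 ≤ f x y) ∧
  (Measurable fun v : (Ici (0 : ℝ) ×ˢ Ici (0 : ℝ) : Set (ℝ × ℝ)) => f v.1.1 v.1.2) ∧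
  (∃ β₁, 0 < β₁ ∧ IsRegVar β₁ b₁) ∧ (∃ β₂, 0 < β₂ ∧ IsRegVar β₂ b₂) ∧
  ∃ (ρ : ℝ) (h : ℝ → ℝ), IsRegVar ρ h ∧ ∀ x y, 0 < x → 0 < y → 0 < L x y ∧
    Tendsto (fun t : ℝ => f (b₁ t * x) (b₂ t * y) / h t) atTop (𝓝 (L x y))

/-- `k` is embeddable (with the given scalings and limit function): `g (x, y) = k ([x], [y])`
is a regularly varying function of two continuous variables. -/
def IsEmbeddable (k : ℕ → ℕ → ℝ) (b₁ b₂ : ℝ → ℝ) (L : ℝ → ℝ → ℝ) : Prop :=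
  ∃ g : ℝ → ℝ → ℝ, IsRegVarBivariate g b₁ b₂ L ∧
    ∀ x y, 0 ≤ x → 0 ≤ y → g x y = k ⌊x⌋₊ ⌊y⌋₊

/-! ### The directed preferential attachment model -/

/-- A finite directed graph, with loops and multiple edges allowed, on the nodes
`0, …, numNodes - 1`; the pair `(v, w)` is an edge from `v` to `w`. -/
@[ext] structure DiMultigraph where
  numNodes : ℕ
  edges : List (ℕ × ℕ)
  valid : ∀ e ∈ edges, e.1 < numNodes ∧ e.2 < numNodes

namespace DiMultigraph

/-- There are countably many such graphs; every set of graphs is an event. -/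
instance : MeasurableSpace DiMultigraph := ⊤

def numEdges (G : DiMultigraph) : ℕ := G.edges.length

def inDegree (G : DiMultigraph) (v : ℕ) : ℕ := G.edges.countP fun e => decide (e.2 = v)

def outDegree (G : DiMultigraph) (v : ℕ) : ℕ := G.edges.countP fun e => decide (e.1 = v)

/-- The number of nodes with in-degree `i` and out-degree `j`. -/
def degreeCount (G : DiMultigraph) (i j : ℕ) : ℕ :=
  (Finset.univ.filter fun v : Fin G.numNodes => G.inDegree v = i ∧ G.outDegree v = j).card

/-- Add an edge from a new node to the existing node `v`. -/
def addNodeTo (G : DiMultigraph) (v : Fin G.numNodes) : DiMultigraph where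
  numNodes := G.numNodes + 1
  edges := (G.numNodes, (v : ℕ)) :: G.edges
  valid := by
    intro e he
    rcases List.mem_cons.1 he with rfl | he
    · exact ⟨Nat.lt_succ_self _, v.2.trans (Nat.lt_succ_self _)⟩
    · exact ⟨(G.valid e he).1.trans (Nat.lt_succ_self _),
        (G.valid e he).2.trans (Nat.lt_succ_self _)⟩

/-- Add an edge from the existing node `v` to a new node. -/
def addNodeFrom (G : DiMultigraph) (v : Fin G.numNodes) : DiMultigraph where
  numNodes := G.numNodes + 1
  edges := ((v : ℕ), G.numNodes) :: G.edges
  valid := by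
    intro e he
    rcases List.mem_cons.1 he with rfl | he
    · exact ⟨v.2.trans (Nat.lt_succ_self _), Nat.lt_succ_self _⟩
    · exact ⟨(G.valid e he).1.trans (Nat.lt_succ_self _),
        (G.valid e he).2.trans (Nat.lt_succ_self _)⟩

/-- Add an edge from the existing node `v` to the existing node `w`. -/
def addEdge (G : DiMultigraph) (v w : Fin G.numNodes) : DiMultigraph where
  numNodes := G.numNodes
  edges := ((v : ℕ), (w : ℕ)) :: G.edges
  valid := by
    intro e he
    rcases List.mem_cons.1 he with rfl | he
    · exact ⟨v.2, w.2⟩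
    · exact G.valid e he

/-- Probability that `v` is chosen according to in-degree. -/
def inChoice (lam : ℝ) (G : DiMultigraph) (v : Fin G.numNodes) : ℝ :=
  (G.inDegree v + lam) / (G.numEdges + lam * G.numNodes)

/-- Probability that `v` is chosen according to out-degree. -/
def outChoice (mu : ℝ) (G : DiMultigraph) (v : Fin G.numNodes) : ℝ :=
  (G.outDegree v + mu) / (G.numEdges + mu * G.numNodes)

open Classical in
/-- One-step transition probability from `G` to `G'`: with probability `α` a new node is attached
to a node chosen by in-degree, with probability `β` an edge is drawn from a node chosen by
out-degree to a node chosen independently by in-degree, and with probability `γ` an edge is drawn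
from a node chosen by out-degree to a new node. -/
def stepProb (α β γ lam mu : ℝ) (G G' : DiMultigraph) : ℝ :=
  α * (∑ v : Fin G.numNodes, if G.addNodeTo v = G' then inChoice lam G v else 0)
  + β * (∑ v : Fin G.numNodes, ∑ w : Fin G.numNodes,
      if G.addEdge v w = G' then outChoice mu G v * inChoice lam G w else 0)
  + γ * (∑ v : Fin G.numNodes, if G.addNodeFrom v = G' then outChoice mu G v else 0)

end DiMultigraph

/-- `(G n)`, for `n ≥ n₀ := G₀.numEdges`, is a preferential attachment process on the probability
space `(Ω, P)` started at `G n₀ = G₀`: a Markov chain with the one-step transition probabilities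
`stepProb`. (The values `G n` for `n < n₀` play no role.) -/
structure IsPreferentialAttachment {Ω : Type*} [MeasurableSpace Ω] (P : Measure Ω)
    (α β γ lam mu : ℝ) (G₀ : DiMultigraph) (G : ℕ → Ω → DiMultigraph) : Prop where
  measurable : ∀ n, G₀.numEdges ≤ n → Measurable (G n)
  initial : ∀ᵐ ω ∂P, G G₀.numEdges ω = G₀
  markov : ∀ n, G₀.numEdges ≤ n → ∀ g : ℕ → DiMultigraph,
    P {ω | ∀ k, G₀.numEdges ≤ k → k ≤ n + 1 → G k ω = g k} =
      P {ω | ∀ k, G₀.numEdges ≤ k → k ≤ n → G k ω = g k} *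
        ENNReal.ofReal (DiMultigraph.stepProb α β γ lam mu (g n) (g (n + 1)))

/-! ### The exponents, the limit function and the deformed unit sphere -/

/-- `c₁ = (α + β) / (1 + lam (α + γ))`. -/
def inExponent (α β γ lam : ℝ) : ℝ := (α + β) / (1 + lam * (α + γ))

/-- `c₂ = (β + γ) / (1 + mu (α + γ))`. -/
def outExponent (α β γ mu : ℝ) : ℝ := (β + γ) / (1 + mu * (α + γ))

/-- The integrand `z ^ (-s) exp (-(x / z + y / z ^ a))`. -/
def mixIntegrand (s a x y z : ℝ) : ℝ := z ^ (-s) * Real.exp (-(x / z + y / z ^ a))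

/-- The limit function, a mixture of two integrals over `(0,∞)`. -/
def limitDensity (α γ lam mu c₁ c₂ x y : ℝ) : ℝ :=
  γ / (α + γ) * (x ^ lam * y ^ (mu - 1) / (c₁ * Real.Gamma (lam + 1) * Real.Gamma mu)) *
      (∫ z in Ioi (0 : ℝ), mixIntegrand (2 + 1 / c₁ + lam + c₂ / c₁ * mu) (c₂ / c₁) x y z)
  + α / (α + γ) * (x ^ (lam - 1) * y ^ mu / (c₁ * Real.Gamma lam * Real.Gamma (mu + 1))) *
      (∫ z in Ioi (0 : ℝ),
        mixIntegrand (1 + c₂ / c₁ + 1 / c₁ + lam + c₂ / c₁ * mu) (c₂ / c₁) x y z)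

/-- `{(x, y) ∈ [0,∞)² : ‖(x ^ (1 / c₁), y ^ (1 / c₂))‖ = 1}` for a norm `ν` on the plane. -/
def deformedSphere (ν : Seminorm ℝ (ℝ × ℝ)) (c₁ c₂ : ℝ) : Set (ℝ × ℝ) :=
  {v | 0 ≤ v.1 ∧ 0 ≤ v.2 ∧ ν (v.1 ^ (1 / c₁), v.2 ^ (1 / c₂)) = 1}

end

/-! In one step the expected change of `N_ij` is a linear balance: gains from `(i-1, j)` and `(i,
j-1)`, losses with weights `i + lam` and `j + mu`, a source at `(1, 0)` and `(0, 1)` from new nodes,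
and a correction of order `1/n` from loops. Since `N(n)/n → α + γ`, the two choice probabilities
become asymptotically `c₁ (i + lam) / n` and `c₂ (j + mu) / n` once weighted by the chance that they
are used. So the limits of `N_ij(n)/N(n)` must satisfy `degreeLaw_recursion`.

This recursion is solved by the law of two independent linear birth processes with rates `c₁ (i +
lam)` and `c₂ (j + mu)`, started at `(1, 0)` with probability `γ/(α + γ)` and at `(0, 1)` otherwise,
observed at an independent standard exponential time. Their one-dimensional laws are negative
binomial (`isBirthLaw_negBinom`), so the limit law is an explicit integral, `degreeLaw`.

Almost sure convergence: increments minus drift are bounded martingale differences, hence average to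
zero (`ae_tendsto_sum_div`). What remains is a deterministic recursion with asymptotically constant
coefficients (`tendsto_div_of_linear_recursion`), solved by induction on `(i, j)` in
`tendsto_degreeCount_div`.

Asymptotics: the negative binomial coefficients behave like `k ^ (δ - 1) / Γ(δ)`, and translating
the exponential time by `log t` turns `(1 - e^(-c s)) ^ m` into a power converging to `exp (-x e^(-c
u))`. Dominated convergence (`tendsto_integral_birth`) gives the limit integral, and `z = e^(c₁ u)`
gives its stated form. The limit is taken along any countably generated filter with moving points,
so it is continuous convergence, which on compact sets is uniform
(`tendstoUniformlyOn_of_tendsto_prod`). -/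

noncomputable section

/-! ### Negative binomial laws of linear birth processes. -/

/-- The shift of a sequence by one place to the right. -/
def shiftSeq (u : ℕ → ℝ) : ℕ → ℝ
  | 0 => 0
  | k + 1 => u k

/-- The coefficient of `x ^ k` in `(1 - x) ^ (-δ)`. -/
def negBinomCoeff (δ : ℝ) (k : ℕ) : ℝ := (∏ j ∈ Finset.range k, (δ + j)) / (k.factorial : ℝ)

/-- The negative binomial probability of `k` with shape `δ` and success probability
`exp (-c s)`. -/
def negBinom (δ c : ℝ) (k : ℕ) (s : ℝ) : ℝ :=
  negBinomCoeff δ k * Real.exp (-(c * δ * s)) * (1 - Real.exp (-(c * s))) ^ k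

theorem negBinomCoeff_zero (δ : ℝ) : negBinomCoeff δ 0 = 1 := by simp [negBinomCoeff]

theorem negBinomCoeff_succ (δ : ℝ) (k : ℕ) :
    ((k : ℝ) + 1) * negBinomCoeff δ (k + 1) = (k + δ) * negBinomCoeff δ k := by
  have h : (k.factorial : ℝ) ≠ 0 := by positivity
  rw [negBinomCoeff, negBinomCoeff, Finset.prod_range_succ, Nat.factorial_succ]
  push_cast
  field_simp
  ring

/-- Compares shapes `δ + 1` and `δ`, so that the shifted process can later be written with the
unshifted coefficients times `i / lam`. -/
theorem negBinomCoeff_succ' (δ : ℝ) (k : ℕ) :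
    ((k : ℝ) + 1) * negBinomCoeff δ (k + 1) = δ * negBinomCoeff (δ + 1) k := by
  have h : (k.factorial : ℝ) ≠ 0 := by positivity
  rw [negBinomCoeff, negBinomCoeff, Finset.prod_range_succ', Nat.factorial_succ]
  have : ∏ j ∈ Finset.range k, (δ + ((j + 1 : ℕ) : ℝ)) = ∏ j ∈ Finset.range k, (δ + 1 + j) :=
    Finset.prod_congr rfl fun j _ => by push_cast; ring
  rw [this]
  push_cast
  field_simp
  ring

theorem negBinomCoeff_pos {δ : ℝ} (hδ : 0 < δ) (k : ℕ) : 0 < negBinomCoeff δ k := by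
  unfold negBinomCoeff
  have : 0 < ∏ j ∈ Finset.range k, (δ + j) := Finset.prod_pos fun j _ => by positivity
  positivity

theorem negBinomCoeff_eq_choose (δ : ℝ) (k : ℕ) :
    negBinomCoeff δ k = Ring.choose (δ + k - 1) k := by
  rw [← Ring.multichoose_eq, negBinomCoeff, div_eq_iff (by positivity), mul_comm,
    ← nsmul_eq_mul, Ring.factorial_nsmul_multichoose_eq_ascPochhammer,
    Polynomial.ascPochhammer_smeval_eq_eval]
  induction k with
  | zero => simp
  | succ k ih => rw [Finset.prod_range_succ, ascPochhammer_succ_eval, ih]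

theorem hasSum_negBinomCoeff (δ : ℝ) {x : ℝ} (h0 : 0 ≤ x) (h1 : x < 1) :
    HasSum (fun k => negBinomCoeff δ k * x ^ k) (1 / (1 - x) ^ δ) := by
  have h := (Real.one_div_one_sub_rpow_hasFPowerSeriesOnBall_zero δ).hasSum (y := x)
    (by simpa [Metric.mem_eball, enorm_eq_nnnorm, ← NNReal.coe_lt_coe, abs_of_nonneg h0] using h1)
  simpa [FormalMultilinearSeries.ofScalars_apply_eq, negBinomCoeff_eq_choose, smul_eq_mul,
    mul_comm] using h

/-- The one-dimensional laws `(a i s)`, `i ∈ ℕ`, of a linear birth process with immigration: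
the state `i` is left for `i + 1` at rate `c (i + lam)`. -/
structure IsBirthLaw (c lam : ℝ) (a : ℕ → ℝ → ℝ) : Prop where
  nonneg : ∀ i s, 0 ≤ s → 0 ≤ a i s
  hasSum : ∀ s, 0 ≤ s → HasSum (fun i => a i s) 1
  hasDerivAt : ∀ i s, HasDerivAt (a i)
    (c * (shiftSeq (fun m => (m + lam) * a m s) i - (i + lam) * a i s)) s

/-- Total mass one is the binomial series at `1 - exp (-c s)`, whose sum is `exp (c δ s)`. The
forward equation reduces to `negBinomCoeff_succ`, whose factor `k + δ` is the birth rate. -/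
theorem isBirthLaw_negBinom {c δ : ℝ} (hc : 0 < c) (hδ : 0 < δ) :
    IsBirthLaw c δ (negBinom δ c) where
  nonneg i s hs := by
    have : Real.exp (-(c * s)) ≤ 1 := Real.exp_le_one_iff.2 (by nlinarith)
    have := (negBinomCoeff_pos hδ i).le
    unfold negBinom
    have h2 : 0 ≤ 1 - Real.exp (-(c * s)) := by linarith
    positivity
  hasSum s hs := by
    have h1 : Real.exp (-(c * s)) ≤ 1 := Real.exp_le_one_iff.2 (by nlinarith)
    have h := (hasSum_negBinomCoeff δ (x := 1 - Real.exp (-(c * s))) (by linarith)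
      (by linarith [Real.exp_pos (-(c * s))])).mul_left (Real.exp (-(c * δ * s)))
    rw [sub_sub_cancel, ← Real.exp_mul, one_div, ← Real.exp_neg, ← Real.exp_add] at h
    rw [show -(c * δ * s) + -(-(c * s) * δ) = 0 by ring, Real.exp_zero] at h
    have e : (fun k => negBinom δ c k s) = fun k => Real.exp (-(c * δ * s)) *
        (negBinomCoeff δ k * (1 - Real.exp (-(c * s))) ^ k) :=
      funext fun k => by unfold negBinom; ring
    rwa [e]
  hasDerivAt i s := by
    have h1 : HasDerivAt (fun s => Real.exp (-(c * δ * s)))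
        (Real.exp (-(c * δ * s)) * -(c * δ)) s := by
      simpa using (((hasDerivAt_id s).const_mul (c * δ)).fun_neg).exp
    have h2 : HasDerivAt (fun s => 1 - Real.exp (-(c * s))) (Real.exp (-(c * s)) * c) s := by
      simpa using ((((hasDerivAt_id s).const_mul c).fun_neg).exp).const_sub 1
    have h3 := (h1.const_mul (negBinomCoeff δ i)).mul (h2.pow i)
    refine h3.congr_deriv ?_
    cases i with
    | zero => simp [negBinom, shiftSeq]; ring
    | succ k =>
      have h := negBinomCoeff_succ δ k
      simp only [negBinom, shiftSeq, Nat.add_sub_cancel, Pi.pow_apply]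
      set E := Real.exp (-(c * s))
      set F := Real.exp (-(c * δ * s))
      push_cast
      linear_combination (c * F * (1 - E) ^ k) * h

/-- If a process leaves `m` at rate `c (m + lam + 1)`, adding one to it gives a process leaving `i =
m + 1` at rate `c (i + lam)`. This supplies the process started at one. -/
theorem IsBirthLaw.shift {c lam : ℝ} {a : ℕ → ℝ → ℝ} (h : IsBirthLaw c (lam + 1) a) :
    IsBirthLaw c lam (fun i s => shiftSeq (fun m => a m s) i) where
  nonneg i s hs := by
    cases i with
    | zero => exact le_rfl
    | succ k => exact h.nonneg k s hs
  hasSum s hs := by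
    rw [← hasSum_nat_add_iff' 1]
    simpa [shiftSeq] using h.hasSum s hs
  hasDerivAt i s := by
    cases i with
    | zero => simpa [shiftSeq] using hasDerivAt_const s (0 : ℝ)
    | succ k =>
      refine (h.hasDerivAt k s).congr_deriv ?_
      cases k with
      | zero => simp only [shiftSeq]; push_cast; ring
      | succ l => simp only [shiftSeq]; push_cast; ring

theorem IsBirthLaw.le_one {c lam : ℝ} {a : ℕ → ℝ → ℝ} (h : IsBirthLaw c lam a) (i : ℕ) {s : ℝ}
    (hs : 0 ≤ s) : a i s ≤ 1 := by
  rw [← (h.hasSum s hs).tsum_eq]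
  exact (h.hasSum s hs).summable.le_tsum i fun j _ => h.nonneg j s hs

theorem IsBirthLaw.continuous {c lam : ℝ} {a : ℕ → ℝ → ℝ} (h : IsBirthLaw c lam a) (i : ℕ) :
    Continuous (a i) :=
  continuous_iff_continuousAt.2 fun s => (h.hasDerivAt i s).continuousAt

/-! ### Mixtures over an exponential time. -/

/-- The joint law of two independent birth processes at an independent standard exponential
time. -/
def expMixture (a b : ℕ → ℝ → ℝ) (i j : ℕ) : ℝ :=
  ∫ s in Ioi (0 : ℝ), Real.exp (-s) * (a i s * b j s)

section Mixture

variable {c lam d mu : ℝ} {a b : ℕ → ℝ → ℝ}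

theorem integrableOn_expMixture (ha : IsBirthLaw c lam a) (hb : IsBirthLaw d mu b) (i j : ℕ) :
    IntegrableOn (fun s => Real.exp (-s) * (a i s * b j s)) (Ioi 0) := by
  refine Integrable.mono' (integrableOn_exp_neg_Ioi 0)
    ((Real.continuous_exp.comp continuous_neg).mul
      ((ha.continuous i).mul (hb.continuous j))).aestronglyMeasurable ?_
  refine (ae_restrict_iff' measurableSet_Ioi).2 (ae_of_all _ fun s hs => ?_)
  have hs' : (0 : ℝ) ≤ s := le_of_lt hs
  have h1 := ha.nonneg i s hs'
  have h2 := hb.nonneg j s hs'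
  have h3 := ha.le_one i hs'
  have h4 := hb.le_one j hs'
  rw [Real.norm_of_nonneg (by positivity)]
  have : a i s * b j s ≤ 1 := by nlinarith
  exact mul_le_of_le_one_right (Real.exp_pos _).le this

theorem expMixture_nonneg (ha : IsBirthLaw c lam a) (hb : IsBirthLaw d mu b) (i j : ℕ) :
    0 ≤ expMixture a b i j :=
  setIntegral_nonneg measurableSet_Ioi fun s hs => by
    have h1 := ha.nonneg i s (le_of_lt hs)
    have h2 := hb.nonneg j s (le_of_lt hs)
    positivity

theorem hasSum_expMixture (ha : IsBirthLaw c lam a) (hb : IsBirthLaw d mu b) :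
    HasSum (fun ij : ℕ × ℕ => expMixture a b ij.1 ij.2) 1 := by
  have key : ∀ s, 0 ≤ s →
      HasSum (fun ij : ℕ × ℕ => Real.exp (-s) * (a ij.1 s * b ij.2 s)) (Real.exp (-s)) := by
    intro s hs
    have h := ((ha.hasSum s hs).mul (hb.hasSum s hs)
      ((ha.hasSum s hs).summable.mul_of_nonneg (hb.hasSum s hs).summable
        (fun i => ha.nonneg i s hs) (fun j => hb.nonneg j s hs))).mul_left (Real.exp (-s))
    simpa using h
  -- The terms are nonnegative, so they serve as their own dominating family, with integrable sum
  -- `exp (-s)`.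
  have h := hasSum_integral_of_dominated_convergence (μ := volume.restrict (Ioi (0 : ℝ)))
    (F := fun (ij : ℕ × ℕ) s => Real.exp (-s) * (a ij.1 s * b ij.2 s))
    (f := fun s => Real.exp (-s))
    (fun ij s => Real.exp (-s) * (a ij.1 s * b ij.2 s))
    (fun ij => (integrableOn_expMixture ha hb ij.1 ij.2).aestronglyMeasurable) ?_ ?_ ?_ ?_
  · rwa [integral_exp_neg_Ioi_zero] at h
  · refine fun ij => (ae_restrict_iff' measurableSet_Ioi).2 (ae_of_all _ fun s hs => ?_)
    have h1 := ha.nonneg ij.1 s (le_of_lt hs)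
    have h2 := hb.nonneg ij.2 s (le_of_lt hs)
    rw [Real.norm_of_nonneg (by positivity)]
  · exact (ae_restrict_iff' measurableSet_Ioi).2 (ae_of_all _ fun s hs =>
      (key s (le_of_lt hs)).summable)
  · refine (integrableOn_exp_neg_Ioi 0).congr ?_
    exact (ae_restrict_iff' measurableSet_Ioi).2 (ae_of_all _ fun s hs =>
      (key s (le_of_lt hs)).tsum_eq.symm)
  · exact (ae_restrict_iff' measurableSet_Ioi).2 (ae_of_all _ fun s hs => key s (le_of_lt hs))

/-- Integrate the derivative of `exp (-s) a_i b_j` over the half line: it vanishes at infinity, the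
value at zero is the source term, and the two forward equations give the shifts. -/
theorem expMixture_recursion (ha : IsBirthLaw c lam a) (hb : IsBirthLaw d mu b) (i j : ℕ) :
    (1 + c * (i + lam) + d * (j + mu)) * expMixture a b i j =
      a i 0 * b j 0 + c * shiftSeq (fun m => (m + lam) * expMixture a b m j) i
        + d * shiftSeq (fun m => (m + mu) * expMixture a b i m) j := by
  have hint := integrableOn_expMixture ha hb
  have e1 : IntegrableOn (fun s => Real.exp (-s) * (shiftSeq (fun m => (m + lam) * a m s) i
      * b j s)) (Ioi 0) ∧ ∫ s in Ioi (0 : ℝ), Real.exp (-s) *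
        (shiftSeq (fun m => (m + lam) * a m s) i * b j s)
        = shiftSeq (fun m => (m + lam) * expMixture a b m j) i := by
    cases i with
    | zero => simp [shiftSeq]
    | succ k =>
      simp only [shiftSeq, expMixture]
      rw [← integral_const_mul]
      have : (fun s => Real.exp (-s) * ((k + lam) * a k s * b j s)) =
          fun s => (k + lam) * (Real.exp (-s) * (a k s * b j s)) := by ext s; ring
      rw [this]
      exact ⟨(hint k j).const_mul _, rfl⟩
  have e2 : IntegrableOn (fun s => Real.exp (-s) * (a i s *
      shiftSeq (fun m => (m + mu) * b m s) j)) (Ioi 0) ∧ ∫ s in Ioi (0 : ℝ), Real.exp (-s) *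
        (a i s * shiftSeq (fun m => (m + mu) * b m s) j)
        = shiftSeq (fun m => (m + mu) * expMixture a b i m) j := by
    cases j with
    | zero => simp [shiftSeq]
    | succ k =>
      simp only [shiftSeq, expMixture]
      rw [← integral_const_mul]
      have : (fun s => Real.exp (-s) * (a i s * ((k + mu) * b k s))) =
          fun s => (k + mu) * (Real.exp (-s) * (a i s * b k s)) := by ext s; ring
      rw [this]
      exact ⟨(hint i k).const_mul _, rfl⟩
  have hd : ∀ s, HasDerivAt (fun s => Real.exp (-s) * (a i s * b j s))
      (c * (Real.exp (-s) * (shiftSeq (fun m => (m + lam) * a m s) i * b j s)) +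
        d * (Real.exp (-s) * (a i s * shiftSeq (fun m => (m + mu) * b m s) j)) -
        (1 + c * (i + lam) + d * (j + mu)) * (Real.exp (-s) * (a i s * b j s))) s := by
    intro s
    have h1 : HasDerivAt (fun s => Real.exp (-s)) (Real.exp (-s) * -1) s := by
      simpa using ((hasDerivAt_id s).fun_neg).exp
    refine (h1.mul ((ha.hasDerivAt i s).mul (hb.hasDerivAt j s))).congr_deriv ?_
    rw [Pi.mul_apply]
    set u := shiftSeq (fun m => (m + lam) * a m s) i
    set v := shiftSeq (fun m => (m + mu) * b m s) j
    ring
  have hi1 := e1.1.const_mul c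
  have hi2 := e2.1.const_mul d
  have hi3 := (hint i j).const_mul (1 + c * (i + lam) + d * (j + mu))
  have hlim : Tendsto (fun s => Real.exp (-s) * (a i s * b j s)) atTop (𝓝 0) := by
    refine squeeze_zero_norm' (a := fun s => Real.exp (-s)) ?_ ?_
    · filter_upwards [eventually_ge_atTop 0] with s hs
      have h1 := ha.nonneg i s hs
      have h2 := hb.nonneg j s hs
      have h3 := ha.le_one i hs
      have h4 := hb.le_one j hs
      rw [Real.norm_of_nonneg (by positivity)]
      have : a i s * b j s ≤ 1 := by nlinarith
      exact mul_le_of_le_one_right (Real.exp_pos _).le this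
    · exact Real.tendsto_exp_atBot.comp tendsto_neg_atTop_atBot
  have h := integral_Ioi_of_hasDerivAt_of_tendsto' (a := 0) (fun s _ => hd s)
    ((hi1.add hi2).sub hi3) hlim
  rw [integral_sub (by exact hi1.add hi2) hi3, integral_add hi1 hi2, integral_const_mul,
    integral_const_mul, integral_const_mul, e1.2, e2.2] at h
  simp only [expMixture] at h ⊢
  simp only [neg_zero, Real.exp_zero, one_mul] at h
  linarith

end Mixture

/-! ### Asymptotics of the coefficients and of the powers. -/

/-- This is Gauss's product for `Γ`. The base `k + 1` in place of `k` keeps the ratio meaningful at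
`k = 0`, so that it is bounded over all `k`. -/
theorem tendsto_negBinomCoeff_div {δ : ℝ} (hδ : 0 < δ) :
    Tendsto (fun k : ℕ => negBinomCoeff δ k / ((k : ℝ) + 1) ^ (δ - 1)) atTop
      (𝓝 (1 / Real.Gamma δ)) := by
  have hG := (Real.Gamma_pos_of_pos hδ).ne'
  have h1 : Tendsto (fun k : ℕ => (k : ℝ) / ((k : ℝ) + 1)) atTop (𝓝 1) :=
    tendsto_natCast_div_add_atTop 1
  have h2 : Tendsto (fun k : ℕ => ((k : ℝ) + 1) / ((k : ℝ) + δ)) atTop (𝓝 1) := by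
    have h3 : Tendsto (fun k : ℕ => (k : ℝ) / (k + δ) + 1 / (k + δ)) atTop (𝓝 (1 + 0)) := by
      refine (tendsto_natCast_div_add_atTop (𝕜 := ℝ) δ).add ?_
      exact tendsto_const_nhds.div_atTop
        (tendsto_atTop_add_const_right _ _ tendsto_natCast_atTop_atTop)
    simpa [add_div] using h3
  have h4 := ((h1.rpow_const (p := δ) (Or.inl one_ne_zero)).mul h2).div
    (Real.GammaSeq_tendsto_Gamma δ) hG
  rw [Real.one_rpow, one_mul] at h4
  refine h4.congr' ?_
  filter_upwards [eventually_gt_atTop 0] with k hk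
  have hk' : (0 : ℝ) < k := by exact_mod_cast hk
  have hp : 0 < ∏ j ∈ Finset.range k, (δ + j) := Finset.prod_pos fun j _ => by positivity
  have hkf : (0 : ℝ) < k.factorial := by positivity
  have hkd : 0 < (k : ℝ) ^ δ := by positivity
  have hkd' : 0 < ((k : ℝ) + 1) ^ δ := by positivity
  have hd : (k : ℝ) + δ ≠ 0 := by positivity
  have hd' : δ + (k : ℝ) ≠ 0 := by positivity
  simp only [Pi.div_apply]
  rw [negBinomCoeff, Real.GammaSeq, Finset.prod_range_succ, Real.div_rpow hk'.le (by positivity),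
    Real.rpow_sub_one (by positivity)]
  field_simp
  ring

theorem negBinomCoeff_one (k : ℕ) : negBinomCoeff 1 k = 1 := by
  induction k with
  | zero => exact negBinomCoeff_zero 1
  | succ k ih =>
    have h := negBinomCoeff_succ 1 k
    rw [ih, mul_one] at h
    have : (k : ℝ) + 1 ≠ 0 := by positivity
    exact mul_left_cancel₀ this (by rw [h, mul_one])

section Scaling

variable {ι : Type*} {l : Filter ι}

/-- For `x > 0` the index tends to infinity and the coefficient asymptotics apply. For `x = 0` the
index may stay bounded: if `δ > 1` a factor tending to zero meets a bounded ratio, and if `δ = 1`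
the coefficients are identically one, in accordance with `0 ^ 0 = 1`. -/
theorem tendsto_scaled_negBinomCoeff {δ x : ℝ} (hδ : 0 < δ) (hx : 0 ≤ x) (hxδ : 0 < x ∨ 1 ≤ δ)
    {T : ι → ℝ} {k : ι → ℕ} (hT : Tendsto T l atTop)
    (hk : Tendsto (fun q => (k q : ℝ) / T q) l (𝓝 x)) :
    Tendsto (fun q => T q ^ (-(δ - 1)) * negBinomCoeff δ (k q)) l
      (𝓝 (x ^ (δ - 1) / Real.Gamma δ)) := by
  have hk1 : Tendsto (fun q => ((k q : ℝ) + 1) / T q) l (𝓝 x) := by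
    have h := hk.add (tendsto_const_nhds.div_atTop hT : Tendsto (fun q => 1 / T q) l (𝓝 0))
    simpa [add_div] using h
  have heq : (fun q => T q ^ (-(δ - 1)) * negBinomCoeff δ (k q)) =ᶠ[l]
      fun q => (((k q : ℝ) + 1) / T q) ^ (δ - 1) *
        (negBinomCoeff δ (k q) / ((k q : ℝ) + 1) ^ (δ - 1)) := by
    filter_upwards [hT.eventually_gt_atTop 0] with q hq
    have h1 : ((k q : ℝ) + 1) ^ (δ - 1) ≠ 0 := (Real.rpow_pos_of_pos (by positivity) _).ne'
    have h2 : T q ^ (δ - 1) ≠ 0 := (Real.rpow_pos_of_pos hq _).ne'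
    rw [Real.div_rpow (by positivity) hq.le, Real.rpow_neg hq.le]
    field_simp
  rw [tendsto_congr' heq]
  rcases hx.lt_or_eq with hx0 | hx0
  · have hkT : Tendsto k l atTop := by
      rw [← tendsto_natCast_atTop_iff (R := ℝ)]
      refine (hk.pos_mul_atTop hx0 hT).congr' ?_
      filter_upwards [hT.eventually_gt_atTop 0] with q hq
      field_simp
    have h := (hk1.rpow_const (p := δ - 1) (Or.inl hx0.ne')).mul
      ((tendsto_negBinomCoeff_div hδ).comp hkT)
    simpa [div_eq_mul_inv] using! h
  · subst hx0
    have hδ1 : 1 ≤ δ := hxδ.resolve_left (lt_irrefl 0)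
    rcases hδ1.eq_or_lt with h1 | h1
    · subst h1
      simpa [negBinomCoeff_one] using tendsto_const_nhds
    · have h2 := hk1.rpow_const (p := δ - 1) (Or.inr (by linarith))
      rw [Real.zero_rpow (by linarith)] at h2 ⊢
      rw [zero_div]
      obtain ⟨C, hC⟩ := (tendsto_negBinomCoeff_div hδ).bddAbove_range
      refine h2.zero_mul_isBoundedUnder_le ⟨C, ?_⟩
      refine eventually_map.2 (Eventually.of_forall fun q => ?_)
      have h3 := hC (mem_range_self (k q))
      have h4 : 0 ≤ negBinomCoeff δ (k q) / ((k q : ℝ) + 1) ^ (δ - 1) :=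
        div_nonneg (negBinomCoeff_pos hδ _).le (by positivity)
      simpa [abs_of_nonneg h4] using h3

/-- The logarithm is squeezed by `1 - 1/w ≤ log w ≤ w - 1` at `w = 1 - x`; no growth of `m` is
required. -/
theorem tendsto_one_sub_pow_exp {v : ℝ} {x : ι → ℝ} {m : ι → ℕ} (hpos : ∀ᶠ q in l, 0 < x q)
    (hx : Tendsto x l (𝓝 0)) (hm : Tendsto (fun q => (m q : ℝ) * x q) l (𝓝 v)) :
    Tendsto (fun q => (1 - x q) ^ m q) l (𝓝 (Real.exp (-v))) := by
  have h1 : Tendsto (fun q => (m q : ℝ) * Real.log (1 - x q)) l (𝓝 (-v)) := by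
    have hlow : Tendsto (fun q => -((m q : ℝ) * x q) * (1 - x q)⁻¹) l (𝓝 (-v)) := by
      have h := hm.neg.mul ((tendsto_const_nhds (x := (1 : ℝ))).sub hx |>.inv₀ (by simp))
      simpa using h
    refine tendsto_of_tendsto_of_tendsto_of_le_of_le' hlow hm.neg ?_ ?_
    · filter_upwards [hpos, hx.eventually_lt_const one_pos] with q h0 h1
      have h2 := Real.one_sub_inv_le_log_of_pos (sub_pos.2 h1)
      have h3 : 1 - (1 - x q)⁻¹ = -(x q * (1 - x q)⁻¹) := by
        have : 1 - x q ≠ 0 := (sub_pos.2 h1).ne'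
        field_simp; ring
      have h4 := mul_le_mul_of_nonneg_left h2 (Nat.cast_nonneg (α := ℝ) (m q))
      rw [h3] at h4
      linarith
    · filter_upwards [hpos, hx.eventually_lt_const one_pos] with q h0 h1
      have h2 := Real.log_le_sub_one_of_pos (sub_pos.2 h1)
      have h4 := mul_le_mul_of_nonneg_left h2 (Nat.cast_nonneg (α := ℝ) (m q))
      linarith
  refine ((Real.continuous_exp.tendsto _).comp h1).congr' ?_
  filter_upwards [hx.eventually_lt_const one_pos] with q h1
  rw [Function.comp_apply, mul_comm, Real.exp_mul, Real.exp_log (sub_pos.2 h1), Real.rpow_natCast]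

end Scaling

/-! ### The limit integral in logarithmic and in original variables. -/

/-- The integrand `exp (-κ u) exp (-(x exp (-c u) + y exp (-d u)))`. -/
def expIntegrand (κ c d x y u : ℝ) : ℝ :=
  Real.exp (-(κ * u)) * Real.exp (-(x * Real.exp (-(c * u)) + y * Real.exp (-(d * u))))

theorem continuous_expIntegrand (κ c d x y : ℝ) : Continuous (expIntegrand κ c d x y) := by
  unfold expIntegrand; fun_prop

theorem expIntegrand_pos (κ c d x y u : ℝ) : 0 < expIntegrand κ c d x y u := by
  unfold expIntegrand; positivity

theorem expIntegrand_comm (κ c d x y u : ℝ) :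
    expIntegrand κ c d x y u = expIntegrand κ d c y x u := by
  unfold expIntegrand; rw [add_comm]

theorem image_exp_mul {c : ℝ} (hc : c ≠ 0) :
    (fun u : ℝ => Real.exp (c * u)) '' univ = Ioi 0 := by
  rw [image_univ]
  ext z
  refine ⟨?_, fun hz => ⟨Real.log z / c, ?_⟩⟩
  · rintro ⟨u, rfl⟩; exact Real.exp_pos _
  · simp only; rw [mul_div_cancel₀ _ hc, Real.exp_log hz]

theorem hasDerivWithinAt_exp_mul (c u : ℝ) :
    HasDerivWithinAt (fun u : ℝ => Real.exp (c * u)) (c * Real.exp (c * u)) univ u := by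
  simpa [mul_comm] using (((hasDerivAt_id u).const_mul c).exp).hasDerivWithinAt (s := univ)

theorem injOn_exp_mul {c : ℝ} (hc : c ≠ 0) : InjOn (fun u : ℝ => Real.exp (c * u)) univ :=
  fun _ _ _ _ h => mul_left_cancel₀ hc (Real.exp_injective h)

/-- After discarding the `y` term, `z = exp (-c u)` turns the integral into a Gamma integral with
exponent `κ / c - 1`. -/
theorem integrable_expIntegrand_aux {κ c d x y : ℝ} (hκ : 0 < κ) (hc : 0 < c) (hx : 0 < x)
    (hy : 0 ≤ y) : Integrable (expIntegrand κ c d x y) := by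
  have h := integrableOn_rpow_mul_exp_neg_mul_rpow (p := 1) (s := κ / c - 1) (b := x)
    (by have := div_pos hκ hc; linarith) one_pos hx
  have hc' : -c ≠ 0 := (neg_neg_of_pos hc).ne
  rw [← image_exp_mul hc', integrableOn_image_iff_integrableOn_abs_deriv_smul MeasurableSet.univ
    (fun u _ => hasDerivWithinAt_exp_mul (-c) u) (injOn_exp_mul hc'), integrableOn_univ] at h
  refine (h.const_mul (1 / c)).mono' (continuous_expIntegrand κ c d x y).aestronglyMeasurable
    (ae_of_all _ fun u => ?_)
  rw [Real.norm_of_nonneg (expIntegrand_pos _ _ _ _ _ _).le]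
  have e1 : Real.exp (-c * u) ^ (κ / c - 1) = Real.exp (-(κ * u)) * Real.exp (c * u) := by
    rw [← Real.exp_mul, ← Real.exp_add]; congr 1; field_simp; ring
  have e2 : Real.exp (c * u) * Real.exp (-c * u) = 1 := by
    rw [← Real.exp_add]; simp
  have e3 : 1 / c * (|(-c) * Real.exp (-c * u)| • (Real.exp (-c * u) ^ (κ / c - 1) *
      Real.exp (-x * Real.exp (-c * u) ^ (1 : ℝ)))) =
      Real.exp (-(κ * u)) * Real.exp (-(x * Real.exp (-(c * u)))) := by
    rw [abs_mul, abs_neg, abs_of_pos hc, abs_of_pos (Real.exp_pos _), e1, Real.rpow_one,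
      smul_eq_mul, neg_mul c u, neg_mul]
    rw [neg_mul] at e2
    field_simp
    linear_combination e2
  rw [e3, expIntegrand]
  refine mul_le_mul_of_nonneg_left (Real.exp_le_exp.2 ?_) (Real.exp_pos _).le
  have := mul_nonneg hy (Real.exp_pos (-(d * u))).le
  linarith

theorem integrable_expIntegrand {κ c d x y : ℝ} (hκ : 0 < κ) (hc : 0 < c) (hd : 0 < d)
    (hx : 0 ≤ x) (hy : 0 ≤ y) (hxy : 0 < x ∨ 0 < y) : Integrable (expIntegrand κ c d x y) := by
  rcases hxy with h | h
  · exact integrable_expIntegrand_aux hκ hc h hy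
  · rw [show expIntegrand κ c d x y = expIntegrand κ d c y x from
      funext fun u => expIntegrand_comm _ _ _ _ _ _]
    exact integrable_expIntegrand_aux hκ hd h hx

theorem integral_expIntegrand_pos {κ c d x y : ℝ} (hκ : 0 < κ) (hc : 0 < c) (hd : 0 < d)
    (hx : 0 ≤ x) (hy : 0 ≤ y) (hxy : 0 < x ∨ 0 < y) : 0 < ∫ u, expIntegrand κ c d x y u := by
  rw [integral_pos_iff_support_of_nonneg (fun u => (expIntegrand_pos _ _ _ _ _ u).le)
    (integrable_expIntegrand hκ hc hd hx hy hxy)]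
  have : Function.support (expIntegrand κ c d x y) = univ :=
    eq_univ_of_forall fun u => (expIntegrand_pos _ _ _ _ _ u).ne'
  simp [this]

/-- The integrand after the substitution `z = exp (c u)`, Jacobian included; integrability and the
value of the integral both follow from it. -/
theorem abs_deriv_smul_mixIntegrand {κ c d : ℝ} (hc : 0 < c) (x y u : ℝ) :
    |c * Real.exp (c * u)| • mixIntegrand (1 + κ / c) (d / c) x y (Real.exp (c * u)) =
      c * expIntegrand κ c d x y u := by
  have e1 : Real.exp (c * u) ^ (-(1 + κ / c)) = Real.exp (-(c * u)) * Real.exp (-(κ * u)) := by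
    rw [← Real.exp_mul, ← Real.exp_add]; congr 1; field_simp; ring
  have e2 : Real.exp (c * u) ^ (d / c) = Real.exp (d * u) := by
    rw [← Real.exp_mul]; congr 1; field_simp
  have e3 : Real.exp (c * u) * Real.exp (-(c * u)) = 1 := by
    rw [← Real.exp_add]; simp
  rw [abs_of_pos (by positivity), smul_eq_mul, mixIntegrand, e1, e2, expIntegrand,
    div_eq_mul_inv x, div_eq_mul_inv y, ← Real.exp_neg, ← Real.exp_neg]
  linear_combination (c * Real.exp (-(κ * u)) *
    Real.exp (-(x * Real.exp (-(c * u)) + y * Real.exp (-(d * u))))) * e3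

theorem integrableOn_mixIntegrand {κ c d x y : ℝ} (hκ : 0 < κ) (hc : 0 < c) (hd : 0 < d)
    (hx : 0 ≤ x) (hy : 0 ≤ y) (hxy : 0 < x ∨ 0 < y) :
    IntegrableOn (mixIntegrand (1 + κ / c) (d / c) x y) (Ioi 0) := by
  rw [← image_exp_mul hc.ne', integrableOn_image_iff_integrableOn_abs_deriv_smul MeasurableSet.univ
    (fun u _ => hasDerivWithinAt_exp_mul c u) (injOn_exp_mul hc.ne'), integrableOn_univ]
  simp only [abs_deriv_smul_mixIntegrand hc]
  exact (integrable_expIntegrand hκ hc hd hx hy hxy).const_mul c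

theorem integral_mixIntegrand {κ c d : ℝ} (hc : 0 < c) (x y : ℝ) :
    ∫ z in Ioi 0, mixIntegrand (1 + κ / c) (d / c) x y z =
      c * ∫ u, expIntegrand κ c d x y u := by
  rw [← image_exp_mul hc.ne', integral_image_eq_integral_abs_deriv_smul MeasurableSet.univ
    (fun u _ => hasDerivWithinAt_exp_mul c u) (injOn_exp_mul hc.ne'), setIntegral_univ,
    ← integral_const_mul]
  simp only [abs_deriv_smul_mixIntegrand hc]

/-! ### Scaling limit of the mixtures. -/

section Scaling

variable {ι : Type*} {l : Filter ι}

/-- Put `s = u + log t`: the prefactor `t ^ κ` cancels, `exp (-c s)` becomes `exp (-c u) / t ^ c`,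
and the powers converge to exponentials under an integrable bound. -/
theorem tendsto_integral_birth [l.IsCountablyGenerated] {κ c d x y : ℝ} (hκ : 0 < κ) (hc : 0 < c)
    (hd : 0 < d) (hx : 0 ≤ x) (hy : 0 ≤ y) (hxy : 0 < x ∨ 0 < y) {t : ι → ℝ} {m n : ι → ℕ}
    (ht : Tendsto t l atTop) (hm : Tendsto (fun q => (m q : ℝ) / t q ^ c) l (𝓝 x))
    (hn : Tendsto (fun q => (n q : ℝ) / t q ^ d) l (𝓝 y)) :
    Tendsto (fun q => t q ^ κ * ∫ s in Ioi (0 : ℝ), Real.exp (-(κ * s)) *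
        ((1 - Real.exp (-(c * s))) ^ m q * (1 - Real.exp (-(d * s))) ^ n q)) l
      (𝓝 (∫ u, expIntegrand κ c d x y u)) := by
  set f : ι → ℝ → ℝ := fun q s => Real.exp (-(κ * s)) *
        ((1 - Real.exp (-(c * s))) ^ m q * (1 - Real.exp (-(d * s))) ^ n q) with hf
  -- The indicator retains the original domain `s > 0`, so every integral is over the same line.
  set F : ι → ℝ → ℝ := fun q u => t q ^ κ * (Ioi (0 : ℝ)).indicator (f q) (u + Real.log (t q))
  have hexp : ∀ {c u τ : ℝ}, 0 < τ →
      Real.exp (-(c * (u + Real.log τ))) = Real.exp (-(c * u)) / τ ^ c := by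
    intro c u τ hτ
    rw [Real.rpow_def_of_pos hτ, ← Real.exp_sub]; congr 1; ring
  have hF : ∀ q u, 0 < t q → 0 < u + Real.log (t q) → F q u = Real.exp (-(κ * u)) *
      ((1 - Real.exp (-(c * u)) / t q ^ c) ^ m q *
        (1 - Real.exp (-(d * u)) / t q ^ d) ^ n q) := by
    intro q u hq hu
    have : t q ^ κ ≠ 0 := (Real.rpow_pos_of_pos hq _).ne'
    simp only [F, indicator_of_mem (show u + Real.log (t q) ∈ Ioi (0 : ℝ) from hu), hf,
      hexp hq]
    field_simp
  have hFint : ∀ q, t q ^ κ * ∫ s in Ioi (0 : ℝ), f q s = ∫ u, F q u := by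
    intro q
    simp only [F]
    rw [integral_const_mul, integral_add_right_eq_self ((Ioi (0 : ℝ)).indicator (f q)),
      integral_indicator measurableSet_Ioi]
  change Tendsto (fun q => t q ^ κ * ∫ s in Ioi (0 : ℝ), f q s) l _
  simp only [hFint]
  -- Half of the limiting exponent gives a bound independent of the index. At a zero limit only
  -- nonnegativity is needed; the other coordinate then ensures integrability.
  have hlow : ∀ {z : ℝ} {r : ι → ℝ}, 0 ≤ z → (∀ᶠ q in l, 0 ≤ r q) → Tendsto r l (𝓝 z) →
      ∀ᶠ q in l, z / 2 ≤ r q := by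
    intro z r hz hr hrz
    rcases hz.eq_or_lt with h | h
    · subst h; simpa using hr
    · exact (hrz.eventually_const_lt (half_lt_self h)).mono fun q hq => hq.le
  have hmx := hlow hx ((ht.eventually_gt_atTop 0).mono fun q hq => by positivity) hm
  have hny := hlow hy ((ht.eventually_gt_atTop 0).mono fun q hq => by positivity) hn
  have hpow : ∀ {c u w z : ℝ} {k : ℕ}, 0 < w → z / 2 ≤ (k : ℝ) / w → Real.exp (-(c * u)) / w ≤ 1 →
      0 ≤ (1 - Real.exp (-(c * u)) / w) ^ k ∧
      (1 - Real.exp (-(c * u)) / w) ^ k ≤ Real.exp (-(z / 2 * Real.exp (-(c * u)))) := by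
    intro c u w z k hw hz h1
    have h0 : 0 ≤ 1 - Real.exp (-(c * u)) / w := by linarith
    refine ⟨by positivity, (pow_le_pow_left₀ h0 (Real.one_sub_le_exp_neg _) k).trans ?_⟩
    rw [← Real.exp_nat_mul]
    refine Real.exp_le_exp.2 ?_
    have := mul_le_mul_of_nonneg_right hz (Real.exp_pos (-(c * u))).le
    have e : (k : ℝ) * -(Real.exp (-(c * u)) / w) = -((k : ℝ) / w * Real.exp (-(c * u))) := by
      ring
    rw [e]; linarith
  refine tendsto_integral_filter_of_dominated_convergence
    (expIntegrand κ c d (x / 2) (y / 2)) ?_ ?_ ?_ ?_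
  · refine Eventually.of_forall fun q => ?_
    refine Measurable.aestronglyMeasurable (Measurable.const_mul ?_ _)
    refine Measurable.comp (Measurable.indicator ?_ measurableSet_Ioi) (measurable_add_const _)
    exact Continuous.measurable (by fun_prop)
  · filter_upwards [ht.eventually_gt_atTop 0, hmx, hny] with q hq hmq hnq
    refine ae_of_all _ fun u => ?_
    by_cases hu : 0 < u + Real.log (t q)
    · rw [hF q u hq hu]
      have h1 : Real.exp (-(c * u)) / t q ^ c ≤ 1 := by
        rw [← hexp hq]; exact Real.exp_le_one_iff.2 (by nlinarith)
      have h2 : Real.exp (-(d * u)) / t q ^ d ≤ 1 := by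
        rw [← hexp hq]; exact Real.exp_le_one_iff.2 (by nlinarith)
      obtain ⟨a0, a1⟩ := hpow (Real.rpow_pos_of_pos hq c) hmq h1
      obtain ⟨b0, b1⟩ := hpow (Real.rpow_pos_of_pos hq d) hnq h2
      rw [Real.norm_of_nonneg (by positivity), expIntegrand, neg_add, Real.exp_add]
      gcongr
    · have : F q u = 0 := by
        simp only [F]; rw [indicator_of_notMem (by simpa using hu), mul_zero]
      rw [this, norm_zero]
      exact (expIntegrand_pos _ _ _ _ _ _).le
  · exact integrable_expIntegrand hκ hc hd (by linarith) (by linarith)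
      (hxy.imp (fun h => by linarith) fun h => by linarith)
  · refine ae_of_all _ fun u => ?_
    have hev : (fun q => F q u) =ᶠ[l] fun q => Real.exp (-(κ * u)) *
        ((1 - Real.exp (-(c * u)) / t q ^ c) ^ m q *
          (1 - Real.exp (-(d * u)) / t q ^ d) ^ n q) := by
      filter_upwards [ht.eventually_gt_atTop 0,
        (Real.tendsto_log_atTop.comp ht).eventually_gt_atTop (-u)] with q hq hu
      exact hF q u hq (by simp only [Function.comp_apply] at hu; linarith)
    rw [tendsto_congr' hev]
    have key : ∀ {c z : ℝ} {k : ι → ℕ}, 0 < c →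
        Tendsto (fun q => (k q : ℝ) / t q ^ c) l (𝓝 z) →
        Tendsto (fun q => (1 - Real.exp (-(c * u)) / t q ^ c) ^ k q) l
          (𝓝 (Real.exp (-(z * Real.exp (-(c * u)))))) := by
      intro c z k hc hk
      refine tendsto_one_sub_pow_exp ?_ ?_ ?_
      · filter_upwards [ht.eventually_gt_atTop 0] with q hq
        positivity
      · exact tendsto_const_nhds.div_atTop ((tendsto_rpow_atTop hc).comp ht)
      · refine (hk.mul_const (Real.exp (-(c * u)))).congr fun q => ?_
        ring
    have h := ((key hc hm).mul (key hd hn)).const_mul (Real.exp (-(κ * u)))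
    rwa [← Real.exp_add, ← neg_add] at h

theorem tendsto_natPred_div {T : ι → ℝ} {k : ι → ℕ} {x : ℝ} (hT : Tendsto T l atTop)
    (hk : Tendsto (fun q => (k q : ℝ) / T q) l (𝓝 x)) :
    Tendsto (fun q => ((k q - 1 : ℕ) : ℝ) / T q) l (𝓝 x) := by
  have h := hk.sub (tendsto_const_nhds.div_atTop hT : Tendsto (fun q => 1 / T q) l (𝓝 0))
  rw [sub_zero] at h
  refine tendsto_of_tendsto_of_tendsto_of_le_of_le' h hk ?_ ?_
  · filter_upwards [hT.eventually_gt_atTop 0] with q hq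
    rw [← sub_div]
    gcongr
    have : (k q : ℝ) ≤ ((k q - 1 + 1 : ℕ) : ℝ) := by
      exact_mod_cast (by omega : k q ≤ k q - 1 + 1)
    push_cast at this
    linarith
  · filter_upwards [hT.eventually_gt_atTop 0] with q hq
    gcongr
    exact Nat.sub_le _ _

theorem expMixture_comm (a b : ℕ → ℝ → ℝ) (i j : ℕ) : expMixture a b i j = expMixture b a j i := by
  simp only [expMixture, mul_comm (a i _)]

/-- Starting at one raises the shape to `lam + 1`, which `negBinomCoeff_succ'` trades for the factor
`i / lam`. This factor vanishes at `i = 0`, so the truncated `i - 1` does no harm. -/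
theorem expMixture_shift_negBinom {lam : ℝ} (hlam : 0 < lam) (mu c d : ℝ) (i j : ℕ) :
    expMixture (fun i s => shiftSeq (fun m => negBinom (lam + 1) c m s) i) (negBinom mu d) i j =
      negBinomCoeff lam i * negBinomCoeff mu j * (i / lam) *
        ∫ s in Ioi (0 : ℝ), Real.exp (-((1 + c * (lam + 1) + d * mu) * s)) *
          ((1 - Real.exp (-(c * s))) ^ (i - 1) * (1 - Real.exp (-(d * s))) ^ j) := by
  cases i with
  | zero => simp [expMixture, shiftSeq]
  | succ k =>
    rw [← integral_const_mul, expMixture]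
    refine integral_congr_ae (ae_of_all _ fun s => ?_)
    have h : negBinomCoeff lam (k + 1) * (((k + 1 : ℕ) : ℝ) / lam) = negBinomCoeff (lam + 1) k := by
      have := negBinomCoeff_succ' lam k
      push_cast
      field_simp
      linarith
    have e : Real.exp (-((1 + c * (lam + 1) + d * mu) * s)) =
        Real.exp (-s) * Real.exp (-(c * (lam + 1) * s)) * Real.exp (-(d * mu * s)) := by
      rw [← Real.exp_add, ← Real.exp_add]; congr 1; ring
    simp only [shiftSeq, negBinom, Nat.add_sub_cancel, e, ← h]
    ring

theorem tendsto_expMixture_shift_negBinom [l.IsCountablyGenerated] {lam mu c d x y : ℝ}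
    (hlam : 0 < lam) (hmu : 0 < mu) (hc : 0 < c)
    (hd : 0 < d) (hx : 0 ≤ x) (hy : 0 ≤ y) (hxy : 0 < x ∨ 0 < y) (hxl : 0 < x ∨ 1 ≤ lam)
    (hym : 0 < y ∨ 1 ≤ mu) {t : ι → ℝ} {i j : ι → ℕ}
    (ht : Tendsto t l atTop) (hi : Tendsto (fun q => (i q : ℝ) / t q ^ c) l (𝓝 x))
    (hj : Tendsto (fun q => (j q : ℝ) / t q ^ d) l (𝓝 y)) :
    Tendsto (fun q => t q ^ (1 + c + d) *
        expMixture (fun i s => shiftSeq (fun m => negBinom (lam + 1) c m s) i) (negBinom mu d)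
          (i q) (j q)) l
      (𝓝 (x ^ (lam - 1) / Real.Gamma lam * (y ^ (mu - 1) / Real.Gamma mu) * (x / lam) *
        ∫ u, expIntegrand (1 + c * (lam + 1) + d * mu) c d x y u)) := by
  have hTc := (tendsto_rpow_atTop hc).comp ht
  have hTd := (tendsto_rpow_atTop hd).comp ht
  have h := (((tendsto_scaled_negBinomCoeff hlam hx hxl hTc hi).mul
    (tendsto_scaled_negBinomCoeff hmu hy hym hTd hj)).mul (hi.div_const lam)).mul
    (tendsto_integral_birth (κ := 1 + c * (lam + 1) + d * mu) (by positivity) hc hd hx hy hxy ht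
      (tendsto_natPred_div hTc hi) hj)
  refine h.congr' ?_
  filter_upwards [ht.eventually_gt_atTop 0] with q hq
  rw [expMixture_shift_negBinom hlam]
  set J := ∫ s in Ioi (0 : ℝ), Real.exp (-((1 + c * (lam + 1) + d * mu) * s)) *
          ((1 - Real.exp (-(c * s))) ^ (i q - 1) * (1 - Real.exp (-(d * s))) ^ j q)
  -- The powers of `t`: the integral brings `1 + c (lam + 1) + d mu`, the coefficients remove `c
  -- (lam - 1) + d (mu - 1)`, and `i / lam` removes `c`.
  have e : (t q ^ c) ^ (-(lam - 1)) * (t q ^ d) ^ (-(mu - 1)) * (t q ^ c)⁻¹ *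
      t q ^ (1 + c * (lam + 1) + d * mu) = t q ^ (1 + c + d) := by
    rw [← Real.rpow_mul hq.le, ← Real.rpow_mul hq.le, ← Real.rpow_neg hq.le,
      ← Real.rpow_add hq, ← Real.rpow_add hq, ← Real.rpow_add hq]
    congr 1; ring
  rw [← e]
  simp only [Function.comp_apply]
  ring

end Scaling

/-! ### The limit law: recursion, regular variation and uniformity. -/

/-- The limiting joint probability of in-degree `i` and out-degree `j`. -/
def degreeLaw (α γ lam mu c₁ c₂ : ℝ) (i j : ℕ) : ℝ :=
  γ / (α + γ) * expMixture (fun i s => shiftSeq (fun m => negBinom (lam + 1) c₁ m s) i)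
      (negBinom mu c₂) i j
  + α / (α + γ) * expMixture (negBinom lam c₁)
      (fun j s => shiftSeq (fun m => negBinom (mu + 1) c₂ m s) j) i j

section DegreeLaw

variable {α γ lam mu c₁ c₂ : ℝ}

theorem degreeLaw_nonneg (hα : 0 < α) (hγ : 0 < γ) (hlam : 0 < lam) (hmu : 0 < mu) (hc₁ : 0 < c₁)
    (hc₂ : 0 < c₂) (i j : ℕ) : 0 ≤ degreeLaw α γ lam mu c₁ c₂ i j := by
  have h1 := expMixture_nonneg (isBirthLaw_negBinom hc₁ (add_pos hlam one_pos)).shift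
    (isBirthLaw_negBinom hc₂ hmu) i j
  have h2 := expMixture_nonneg (isBirthLaw_negBinom hc₁ hlam)
    (isBirthLaw_negBinom hc₂ (add_pos hmu one_pos)).shift i j
  unfold degreeLaw
  positivity

theorem hasSum_degreeLaw (hα : 0 < α) (hγ : 0 < γ) (hlam : 0 < lam) (hmu : 0 < mu) (hc₁ : 0 < c₁)
    (hc₂ : 0 < c₂) : HasSum (fun ij : ℕ × ℕ => degreeLaw α γ lam mu c₁ c₂ ij.1 ij.2) 1 := by
  have h1 := hasSum_expMixture (isBirthLaw_negBinom hc₁ (add_pos hlam one_pos)).shift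
    (isBirthLaw_negBinom hc₂ hmu)
  have h2 := hasSum_expMixture (isBirthLaw_negBinom hc₁ hlam)
    (isBirthLaw_negBinom hc₂ (add_pos hmu one_pos)).shift
  have h := (h1.mul_left (γ / (α + γ))).add (h2.mul_left (α / (α + γ)))
  have e : γ / (α + γ) * 1 + α / (α + γ) * 1 = 1 := by
    have : α + γ ≠ 0 := by positivity
    field_simp; ring
  rw [e] at h
  exact h

theorem negBinom_at_zero (δ c : ℝ) (k : ℕ) : negBinom δ c k 0 = if k = 0 then 1 else 0 := by
  cases k with
  | zero => simp [negBinom, negBinomCoeff_zero]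
  | succ k => simp [negBinom]

theorem degreeLaw_recursion (hlam : 0 < lam) (hmu : 0 < mu) (hc₁ : 0 < c₁)
    (hc₂ : 0 < c₂) (i j : ℕ) :
    (1 + c₁ * (i + lam) + c₂ * (j + mu)) * degreeLaw α γ lam mu c₁ c₂ i j =
      γ / (α + γ) * (if i = 1 ∧ j = 0 then 1 else 0) +
      α / (α + γ) * (if i = 0 ∧ j = 1 then 1 else 0) +
      c₁ * shiftSeq (fun m => (m + lam) * degreeLaw α γ lam mu c₁ c₂ m j) i +
      c₂ * shiftSeq (fun m => (m + mu) * degreeLaw α γ lam mu c₁ c₂ i m) j := by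
  have h1 := expMixture_recursion (isBirthLaw_negBinom hc₁ (add_pos hlam one_pos)).shift
    (isBirthLaw_negBinom hc₂ hmu) i j
  have h2 := expMixture_recursion (isBirthLaw_negBinom hc₁ hlam)
    (isBirthLaw_negBinom hc₂ (add_pos hmu one_pos)).shift i j
  have hs : ∀ (u v : ℕ → ℝ) (z A B : ℝ) (k : ℕ), shiftSeq (fun m => (m + z) * (A * u m + B * v m)) k
      = A * shiftSeq (fun m => (m + z) * u m) k + B * shiftSeq (fun m => (m + z) * v m) k := by
    intro u v z A B k
    cases k with
    | zero => simp [shiftSeq]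
    | succ k => simp only [shiftSeq]; ring
  have i1 : shiftSeq (fun m => negBinom (lam + 1) c₁ m 0) i * negBinom mu c₂ j 0 =
      if i = 1 ∧ j = 0 then 1 else 0 := by
    rcases i with _ | _ | i <;> rcases j with _ | j <;> simp [shiftSeq, negBinom_at_zero]
  have i2 : negBinom lam c₁ i 0 * shiftSeq (fun m => negBinom (mu + 1) c₂ m 0) j =
      if i = 0 ∧ j = 1 then 1 else 0 := by
    rcases j with _ | _ | j <;> rcases i with _ | i <;> simp [shiftSeq, negBinom_at_zero]
  rw [i1] at h1
  rw [i2] at h2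
  simp only [degreeLaw]
  rw [hs, hs]
  linear_combination (γ / (α + γ)) * h1 + (α / (α + γ)) * h2

/-- Brings both summands to the form produced by the scaling limit, the second with the roles of the
coordinates exchanged. The identity `x ^ lam = x ^ (lam - 1) * x` persists at `x = 0` because `lam >
0`, so the axes are covered. -/
theorem limitDensity_eq (hlam : 0 < lam) (hmu : 0 < mu) (hc₁ : 0 < c₁) {x y : ℝ}
    (hx : 0 ≤ x) (hy : 0 ≤ y) :
    limitDensity α γ lam mu c₁ c₂ x y =
      γ / (α + γ) * (x ^ (lam - 1) / Real.Gamma lam * (y ^ (mu - 1) / Real.Gamma mu) * (x / lam) *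
        ∫ u, expIntegrand (1 + c₁ * (lam + 1) + c₂ * mu) c₁ c₂ x y u) +
      α / (α + γ) * (y ^ (mu - 1) / Real.Gamma mu * (x ^ (lam - 1) / Real.Gamma lam) * (y / mu) *
        ∫ u, expIntegrand (1 + c₂ * (mu + 1) + c₁ * lam) c₂ c₁ y x u) := by
  have hpow : ∀ {x z : ℝ}, 0 ≤ x → 0 < z → x ^ z = x ^ (z - 1) * x := by
    intro x z hx hz
    rcases hx.eq_or_lt with h | h
    · subst h; rw [Real.zero_rpow hz.ne', mul_zero]
    · rw [Real.rpow_sub_one h.ne', div_mul_cancel₀ _ h.ne']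
  have e1 : 2 + 1 / c₁ + lam + c₂ / c₁ * mu = 1 + (1 + c₁ * (lam + 1) + c₂ * mu) / c₁ := by
    field_simp; ring
  have e2 : 1 + c₂ / c₁ + 1 / c₁ + lam + c₂ / c₁ * mu =
      1 + (1 + c₂ * (mu + 1) + c₁ * lam) / c₁ := by
    field_simp; ring
  have e3 : (∫ u, expIntegrand (1 + c₂ * (mu + 1) + c₁ * lam) c₂ c₁ y x u) =
      ∫ u, expIntegrand (1 + c₂ * (mu + 1) + c₁ * lam) c₁ c₂ x y u :=
    integral_congr_ae (ae_of_all _ fun u => expIntegrand_comm _ _ _ _ _ _)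
  have g1 := (Real.Gamma_pos_of_pos hlam).ne'
  have g2 := (Real.Gamma_pos_of_pos hmu).ne'
  rw [limitDensity, e1, e2, e3, integral_mixIntegrand hc₁, integral_mixIntegrand hc₁,
    hpow hx hlam, hpow hy hmu, Real.Gamma_add_one hlam.ne', Real.Gamma_add_one hmu.ne']
  field_simp

theorem limitDensity_pos (hα : 0 < α) (hγ : 0 < γ) (hlam : 0 < lam) (hmu : 0 < mu)
    (hc₁ : 0 < c₁) (hc₂ : 0 < c₂) {x y : ℝ} (hx : 0 < x) (hy : 0 < y) :
    0 < limitDensity α γ lam mu c₁ c₂ x y := by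
  rw [limitDensity_eq hlam hmu hc₁ hx.le hy.le]
  have i1 := integral_expIntegrand_pos (κ := 1 + c₁ * (lam + 1) + c₂ * mu) (by positivity)
    hc₁ hc₂ hx.le hy.le (Or.inl hx)
  have i2 := integral_expIntegrand_pos (κ := 1 + c₂ * (mu + 1) + c₁ * lam) (by positivity)
    hc₂ hc₁ hy.le hx.le (Or.inl hy)
  have g1 := Real.Gamma_pos_of_pos hlam
  have g2 := Real.Gamma_pos_of_pos hmu
  positivity

theorem tendsto_floor_mul_div {ι : Type*} {l : Filter ι} {T x : ι → ℝ} {z : ℝ}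
    (hT : Tendsto T l atTop) (hx : Tendsto x l (𝓝 z)) (hx0 : ∀ᶠ q in l, 0 ≤ x q) :
    Tendsto (fun q => (⌊T q * x q⌋₊ : ℝ) / T q) l (𝓝 z) := by
  have h := hx.sub (tendsto_const_nhds.div_atTop hT : Tendsto (fun q => 1 / T q) l (𝓝 0))
  rw [sub_zero] at h
  refine tendsto_of_tendsto_of_tendsto_of_le_of_le' h hx ?_ ?_
  · filter_upwards [hT.eventually_gt_atTop 0] with q hq
    rw [le_div_iff₀ hq, sub_mul, div_mul_cancel₀ _ hq.ne', mul_comm]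
    exact (Nat.sub_one_lt_floor _).le
  · filter_upwards [hT.eventually_gt_atTop 0, hx0] with q hq hq0
    rw [div_le_iff₀ hq, mul_comm]
    exact Nat.floor_le (mul_nonneg hq0 hq.le)

/-- The points `x q`, `y q` may move with the index; this single form yields both the pointwise
limits and the uniform convergence. -/
theorem tendsto_degreeLaw (hlam : 0 < lam) (hmu : 0 < mu)
    (hc₁ : 0 < c₁) (hc₂ : 0 < c₂) {ι : Type*} {l : Filter ι} [l.IsCountablyGenerated]
    {t x y : ι → ℝ} {x₀ y₀ : ℝ} (ht : Tendsto t l atTop) (hx : Tendsto x l (𝓝 x₀))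
    (hy : Tendsto y l (𝓝 y₀)) (hx0 : ∀ᶠ q in l, 0 ≤ x q) (hy0 : ∀ᶠ q in l, 0 ≤ y q)
    (hx₀ : 0 ≤ x₀) (hy₀ : 0 ≤ y₀) (hxy : 0 < x₀ ∨ 0 < y₀) (hxl : 0 < x₀ ∨ 1 ≤ lam)
    (hym : 0 < y₀ ∨ 1 ≤ mu) :
    Tendsto (fun q => degreeLaw α γ lam mu c₁ c₂ ⌊t q ^ c₁ * x q⌋₊ ⌊t q ^ c₂ * y q⌋₊ /
      t q ^ (-(1 + c₁ + c₂))) l (𝓝 (limitDensity α γ lam mu c₁ c₂ x₀ y₀)) := by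
  have hi := tendsto_floor_mul_div ((tendsto_rpow_atTop hc₁).comp ht) hx hx0
  have hj := tendsto_floor_mul_div ((tendsto_rpow_atTop hc₂).comp ht) hy hy0
  have h1 := tendsto_expMixture_shift_negBinom hlam hmu hc₁ hc₂ hx₀ hy₀ hxy hxl hym ht hi hj
  have h2 := tendsto_expMixture_shift_negBinom hmu hlam hc₂ hc₁ hy₀ hx₀ hxy.symm hym hxl ht hj hi
  rw [limitDensity_eq hlam hmu hc₁ hx₀ hy₀]
  refine ((h1.const_mul (γ / (α + γ))).add (h2.const_mul (α / (α + γ)))).congr' ?_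
  filter_upwards [ht.eventually_gt_atTop 0] with q hq
  rw [degreeLaw, expMixture_comm (negBinom lam c₁), Real.rpow_neg hq.le, div_inv_eq_mul,
    show 1 + c₂ + c₁ = 1 + c₁ + c₂ by ring]
  simp only [Function.comp_apply]
  ring

/-- Continuous convergence on a compact set is uniform. Neither the functions nor the limit need be
continuous a priori. -/
theorem tendstoUniformlyOn_of_tendsto_prod {ι X : Type*} [TopologicalSpace X] {l : Filter ι}
    [l.NeBot] {K : Set X} (hK : IsCompact K) {F : ι → X → ℝ} {f : X → ℝ}
    (h : ∀ v ∈ K, Tendsto (fun q : ι × X => F q.1 q.2) (l ×ˢ 𝓝[K] v) (𝓝 (f v))) :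
    TendstoUniformlyOn F f l K := by
  rw [← tendstoLocallyUniformlyOn_iff_tendstoUniformlyOn_of_compact hK,
    Metric.tendstoLocallyUniformlyOn_iff]
  intro ε hε v hv
  obtain ⟨A, hA, B, hB, hAB⟩ := mem_prod_iff.1
    ((h v hv) (Metric.ball_mem_nhds (f v) (show 0 < ε / 4 by positivity)))
  refine ⟨B ∩ K, inter_mem hB self_mem_nhdsWithin, ?_⟩
  filter_upwards [hA] with n hn w hw
  have hlim : Tendsto (fun n => F n w) l (𝓝 (f w)) :=
    (h w hw.2).comp (tendsto_id.prodMk (tendsto_const_nhdsWithin hw.2))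
  have h1 : ∀ m ∈ A, dist (F m w) (f v) < ε / 4 := fun m hm =>
    Metric.mem_ball.1 (hAB (show (m, w) ∈ A ×ˢ B from ⟨hm, hw.1⟩))
  -- The bound on `F m w` passes to its limit at the fixed point `w`, which controls the oscillation
  -- of `f` near `v`.
  have h2 : dist (f w) (f v) ≤ ε / 4 :=
    le_of_tendsto (hlim.dist tendsto_const_nhds)
      (mem_of_superset hA fun m hm => (h1 m hm).le)
  have h3 := dist_triangle_right (f w) (F n w) (f v)
  have h4 := h1 n hn
  linarith

theorem tendstoUniformlyOn_degreeLaw (hlam : 0 < lam) (hmu : 0 < mu)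
    (hc₁ : 0 < c₁) (hc₂ : 0 < c₂) {K : Set (ℝ × ℝ)} (hK : IsCompact K) (hK0 : K ⊆ Ici 0 ×ˢ Ici 0)
    (h0 : (0, 0) ∉ K) (hl : lam < 1 → ∀ v ∈ K, 0 < v.1) (hm : mu < 1 → ∀ v ∈ K, 0 < v.2) :
    TendstoUniformlyOn (fun (t : ℝ) (v : ℝ × ℝ) =>
        degreeLaw α γ lam mu c₁ c₂ ⌊t ^ c₁ * v.1⌋₊ ⌊t ^ c₂ * v.2⌋₊ / t ^ (-(1 + c₁ + c₂)))
      (fun v => limitDensity α γ lam mu c₁ c₂ v.1 v.2) atTop K := by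
  refine tendstoUniformlyOn_of_tendsto_prod hK fun v hv => ?_
  have hvs : Tendsto (fun q : ℝ × (ℝ × ℝ) => q.2) (atTop ×ˢ 𝓝[K] v) (𝓝 v) :=
    tendsto_snd.mono_right nhdsWithin_le_nhds
  have hvK : ∀ᶠ q : ℝ × (ℝ × ℝ) in atTop ×ˢ 𝓝[K] v, q.2 ∈ K :=
    tendsto_snd.eventually (self_mem_nhdsWithin : K ∈ 𝓝[K] v)
  have hv1 : 0 ≤ v.1 := (hK0 hv).1
  have hv2 : 0 ≤ v.2 := (hK0 hv).2
  refine tendsto_degreeLaw hlam hmu hc₁ hc₂ tendsto_fst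
    ((continuous_fst.tendsto v).comp hvs) ((continuous_snd.tendsto v).comp hvs)
    (hvK.mono fun q hq => (hK0 hq).1) (hvK.mono fun q hq => (hK0 hq).2) hv1 hv2 ?_ ?_ ?_
  · by_contra! hcon
    exact h0 ((Prod.ext (le_antisymm hcon.1 hv1) (le_antisymm hcon.2 hv2) : v = (0, 0)) ▸ hv)
  · exact (lt_or_ge lam 1).imp (fun h => hl h v hv) id
  · exact (lt_or_ge mu 1).imp (fun h => hm h v hv) id

theorem isRegVar_rpow (ρ : ℝ) : IsRegVar ρ fun t => t ^ ρ where
  pos t ht := Real.rpow_pos_of_pos ht ρ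
  measurable := (measurable_subtype_coe.pow_const ρ)
  tendsto x hx := by
    refine tendsto_const_nhds.congr' ?_
    filter_upwards [eventually_gt_atTop 0] with t ht
    have := (Real.rpow_pos_of_pos ht ρ).ne'
    rw [Real.mul_rpow ht.le hx.le]
    field_simp

theorem tendsto_degreeLaw_real (hlam : 0 < lam) (hmu : 0 < mu)
    (hc₁ : 0 < c₁) (hc₂ : 0 < c₂) {x y : ℝ} (hx : 0 < x) (hy : 0 < y) :
    Tendsto (fun t : ℝ => degreeLaw α γ lam mu c₁ c₂ ⌊t ^ c₁ * x⌋₊ ⌊t ^ c₂ * y⌋₊ /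
      t ^ (-(1 + c₁ + c₂))) atTop (𝓝 (limitDensity α γ lam mu c₁ c₂ x y)) :=
  tendsto_degreeLaw hlam hmu hc₁ hc₂ tendsto_id tendsto_const_nhds tendsto_const_nhds
    (Eventually.of_forall fun _ => hx.le) (Eventually.of_forall fun _ => hy.le) hx.le hy.le
    (Or.inl hx) (Or.inl hx) (Or.inl hy)

theorem isRegVarDiscrete_degreeLaw (hα : 0 < α) (hγ : 0 < γ) (hlam : 0 < lam) (hmu : 0 < mu)
    (hc₁ : 0 < c₁) (hc₂ : 0 < c₂) :
    IsRegVarDiscrete (degreeLaw α γ lam mu c₁ c₂) (fun t => t ^ c₁) (fun t => t ^ c₂)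
      (limitDensity α γ lam mu c₁ c₂) :=
  ⟨degreeLaw_nonneg hα hγ hlam hmu hc₁ hc₂, ⟨c₁, hc₁, isRegVar_rpow c₁⟩,
    ⟨c₂, hc₂, isRegVar_rpow c₂⟩, -(1 + c₁ + c₂), _, isRegVar_rpow _, fun _ _ hx hy =>
    ⟨limitDensity_pos hα hγ hlam hmu hc₁ hc₂ hx hy,
      (tendsto_degreeLaw_real hlam hmu hc₁ hc₂ hx hy).comp tendsto_natCast_atTop_atTop⟩⟩

theorem isEmbeddable_degreeLaw (hα : 0 < α) (hγ : 0 < γ) (hlam : 0 < lam) (hmu : 0 < mu)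
    (hc₁ : 0 < c₁) (hc₂ : 0 < c₂) :
    IsEmbeddable (degreeLaw α γ lam mu c₁ c₂) (fun t => t ^ c₁) (fun t => t ^ c₂)
      (limitDensity α γ lam mu c₁ c₂) := by
  refine ⟨fun x y => degreeLaw α γ lam mu c₁ c₂ ⌊x⌋₊ ⌊y⌋₊,
    ⟨fun x y _ _ => degreeLaw_nonneg hα hγ hlam hmu hc₁ hc₂ _ _, ?_, ⟨c₁, hc₁, isRegVar_rpow c₁⟩,
      ⟨c₂, hc₂, isRegVar_rpow c₂⟩, -(1 + c₁ + c₂), _, isRegVar_rpow _, fun x y hx hy =>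
      ⟨limitDensity_pos hα hγ hlam hmu hc₁ hc₂ hx hy,
        tendsto_degreeLaw_real hlam hmu hc₁ hc₂ hx hy⟩⟩, fun _ _ _ _ => rfl⟩
  have h1 : Measurable fun ij : ℕ × ℕ => degreeLaw α γ lam mu c₁ c₂ ij.1 ij.2 :=
    Measurable.of_discrete
  have h2 : Measurable fun v : (Ici (0 : ℝ) ×ˢ Ici (0 : ℝ) : Set (ℝ × ℝ)) =>
      (⌊v.1.1⌋₊, ⌊v.1.2⌋₊) :=
    (Nat.measurable_floor.comp (measurable_fst.comp measurable_subtype_coe)).prodMk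
      (Nat.measurable_floor.comp (measurable_snd.comp measurable_subtype_coe))
  exact h1.comp h2

end DegreeLaw

/-! ### Compactness of the deformed unit sphere. -/

theorem Seminorm.continuous_prod_real (ν : Seminorm ℝ (ℝ × ℝ)) : Continuous ν := by
  have hle : ∀ v : ℝ × ℝ, ν v ≤ |v.1| * ν (1, 0) + |v.2| * ν (0, 1) := by
    intro v
    have e : v = v.1 • ((1 : ℝ), (0 : ℝ)) + v.2 • ((0 : ℝ), (1 : ℝ)) := by ext <;> simp
    calc ν v = ν (v.1 • ((1 : ℝ), (0 : ℝ)) + v.2 • ((0 : ℝ), (1 : ℝ))) := by rw [← e]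
      _ ≤ _ := map_add_le_add ν _ _
      _ = _ := by rw [map_smul_eq_mul, map_smul_eq_mul]; rfl
  refine continuous_iff_continuousAt.2 fun v => ?_
  have h0 : Tendsto (fun w : ℝ × ℝ => |(w - v).1| * ν (1, 0) + |(w - v).2| * ν (0, 1)) (𝓝 v)
      (𝓝 0) := by
    have : Continuous fun w : ℝ × ℝ =>
        |(w - v).1| * ν (1, 0) + |(w - v).2| * ν (0, 1) := by fun_prop
    simpa using this.tendsto v
  rw [ContinuousAt, tendsto_iff_dist_tendsto_zero]
  exact squeeze_zero (fun _ => dist_nonneg)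
    (fun w => (abs_sub_map_le_sub ν w v).trans (hle (w - v))) h0

theorem isCompact_sphere_of_norm (ν : Seminorm ℝ (ℝ × ℝ)) (hν : ∀ v, ν v = 0 → v = 0) :
    IsCompact {v : ℝ × ℝ | ν v = 1} := by
  have hcont := ν.continuous_prod_real
  have hne : (Metric.sphere (0 : ℝ × ℝ) 1).Nonempty := ⟨(1, 0), by simp [Prod.norm_def]⟩
  obtain ⟨w, hw, hmin⟩ := (isCompact_sphere (0 : ℝ × ℝ) 1).exists_isMinOn hne hcont.continuousOn
  have hw0 : 0 < ν w := by
    refine lt_of_le_of_ne (apply_nonneg ν w) fun h => ?_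
    rw [hν w h.symm] at hw
    simp at hw
  refine Metric.isCompact_of_isClosed_isBounded (isClosed_eq hcont continuous_const) ?_
  refine (Metric.isBounded_closedBall (x := (0 : ℝ × ℝ)) (r := 1 / ν w)).subset fun v hv => ?_
  have hv1 : ν v = 1 := hv
  have hv0 : v ≠ 0 := by rintro rfl; simp at hv1
  have hvn : 0 < ‖v‖ := norm_pos_iff.2 hv0
  have h := hmin (show ‖v‖⁻¹ • v ∈ Metric.sphere (0 : ℝ × ℝ) 1 by
    simp [norm_smul, hvn.ne'])
  have h' : ν w ≤ ν (‖v‖⁻¹ • v) := h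
  rw [map_smul_eq_mul, hv1, mul_one, norm_inv, norm_norm] at h'
  rw [mem_closedBall_zero_iff, le_div_iff₀ hw0]
  calc ‖v‖ * ν w ≤ ‖v‖ * ‖v‖⁻¹ := by gcongr
    _ = 1 := mul_inv_cancel₀ hvn.ne'

/-- The map `(x, y) ↦ (x ^ c₁, y ^ c₂)` carries the compact part of the unit sphere of `ν` in the
quadrant onto a set containing the deformed one, and it sends only the origin to the origin. -/
theorem exists_isCompact_deformedSphere_subset (ν : Seminorm ℝ (ℝ × ℝ)) (hν : ∀ v, ν v = 0 → v = 0)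
    {c₁ c₂ : ℝ} (hc₁ : 0 < c₁) (hc₂ : 0 < c₂) :
    ∃ K : Set (ℝ × ℝ), IsCompact K ∧ K ⊆ Ici 0 ×ˢ Ici 0 ∧ (0, 0) ∉ K ∧
      deformedSphere ν c₁ c₂ ⊆ K := by
  have hS : IsCompact ({v : ℝ × ℝ | ν v = 1} ∩ (Ici 0 ×ˢ Ici 0)) :=
    (isCompact_sphere_of_norm ν hν).inter_right (isClosed_Ici.prod isClosed_Ici)
  have hf : Continuous fun v : ℝ × ℝ => (v.1 ^ c₁, v.2 ^ c₂) :=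
    (continuous_fst.rpow_const fun _ => Or.inr hc₁.le).prodMk
      (continuous_snd.rpow_const fun _ => Or.inr hc₂.le)
  refine ⟨_, hS.image hf, ?_, ?_, ?_⟩
  · rintro _ ⟨v, ⟨-, hv1, hv2⟩, rfl⟩
    exact ⟨Real.rpow_nonneg hv1 _, Real.rpow_nonneg hv2 _⟩
  · rintro ⟨v, ⟨hv, hv1, hv2⟩, h⟩
    have e1 := (Real.rpow_eq_zero hv1 hc₁.ne').1 (congrArg Prod.fst h)
    have e2 := (Real.rpow_eq_zero hv2 hc₂.ne').1 (congrArg Prod.snd h)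
    have hv' : ν v = 1 := hv
    rw [show v = 0 from Prod.ext e1 e2, map_zero] at hv'
    exact zero_ne_one hv'
  · rintro v ⟨hv1, hv2, hv⟩
    refine ⟨(v.1 ^ (1 / c₁), v.2 ^ (1 / c₂)),
      ⟨hv, Real.rpow_nonneg hv1 _, Real.rpow_nonneg hv2 _⟩, ?_⟩
    simp only
    rw [← Real.rpow_mul hv1, ← Real.rpow_mul hv2, one_div_mul_cancel hc₁.ne',
      one_div_mul_cancel hc₂.ne', Real.rpow_one, Real.rpow_one]

/-! ### Deterministic recursions and averages. -/

theorem tendsto_div_of_abs_le_add {z ε : ℕ → ℝ} (hε : Tendsto ε atTop (𝓝 0))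
    (h : ∀ᶠ n in atTop, |z (n + 1)| ≤ |z n| + |ε n|) :
    Tendsto (fun n => z n / n) atTop (𝓝 0) := by
  obtain ⟨N, hN⟩ := eventually_atTop.1 h
  have hbound : ∀ n, N ≤ n → |z n| ≤ |z N| + ∑ k ∈ Finset.range n, |ε k| := by
    intro n hn
    induction n, hn using Nat.le_induction with
    | base => linarith [Finset.sum_nonneg fun k (_ : k ∈ Finset.range N) => abs_nonneg (ε k)]
    | succ n hn ih => rw [Finset.sum_range_succ]; linarith [hN n hn]
  have hces := (hε.abs).cesaro
  rw [abs_zero] at hces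
  have hlim := ((tendsto_const_div_atTop_nhds_zero_nat |z N|)).add hces
  rw [add_zero] at hlim
  refine squeeze_zero_norm' ?_ hlim
  filter_upwards [eventually_ge_atTop N, eventually_gt_atTop 0] with n hn hn0
  have hn0' : (0 : ℝ) < n := by exact_mod_cast hn0
  rw [norm_div, Real.norm_eq_abs, Real.norm_of_nonneg hn0'.le, div_eq_inv_mul, div_eq_inv_mul,
    ← mul_add]
  exact mul_le_mul_of_nonneg_left (hbound n hn) (by positivity)

/-- Subtract the accumulated noise `M n` and the linear guess `n * r`, with `r` solving `b = r (1 +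
a)`. The remainder is multiplied by `1 - A n / n`, eventually in `[0, 1]`, and receives errors
tending to zero; these average out by Cesàro. -/
theorem tendsto_div_of_linear_recursion {x A B D : ℕ → ℝ} {a b : ℝ} (ha : 0 ≤ a)
    (hA : Tendsto A atTop (𝓝 a)) (hA0 : ∀ᶠ n in atTop, 0 ≤ A n) (hB : Tendsto B atTop (𝓝 b))
    (hD : Tendsto (fun n : ℕ => (∑ k ∈ Finset.range n, D k) / n) atTop (𝓝 0))
    (hx : ∀ᶠ n : ℕ in atTop, x (n + 1) = x n - A n * (x n / n) + B n + D n) :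
    Tendsto (fun n : ℕ => x n / n) atTop (𝓝 (b / (1 + a))) := by
  set r := b / (1 + a) with hr
  set M : ℕ → ℝ := fun n => ∑ k ∈ Finset.range n, D k with hM
  set z : ℕ → ℝ := fun n => x n - M n - n * r with hz
  have hε : Tendsto (fun n => B n - r * (1 + A n) - A n * (M n / n)) atTop (𝓝 0) := by
    have h := (hB.sub ((tendsto_const_nhds (x := (1 : ℝ)).add hA).const_mul r)).sub (hA.mul hD)
    have e : b - r * (1 + a) - a * 0 = 0 := by
      rw [hr, div_mul_cancel₀ _ (by positivity)]; ring
    rwa [e] at h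
  have hAn : ∀ᶠ n : ℕ in atTop, A n ≤ n := by
    filter_upwards [hA.eventually_lt_const (lt_add_one a),
      tendsto_natCast_atTop_atTop.eventually_ge_atTop (a + 1)] with n h1 h2
    linarith
  have hz0 : Tendsto (fun n => z n / n) atTop (𝓝 0) := by
    refine tendsto_div_of_abs_le_add hε ?_
    filter_upwards [hx, hA0, hAn, eventually_gt_atTop 0] with n h1 h2 h3 h4
    have h4' : (0 : ℝ) < n := by exact_mod_cast h4
    have e : z (n + 1) = z n * (1 - A n / n) + (B n - r * (1 + A n) - A n * (M n / n)) := by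
      simp only [hz, h1, hM, Finset.sum_range_succ]
      push_cast
      field_simp
      ring
    rw [e]
    refine (abs_add_le _ _).trans (add_le_add ?_ le_rfl)
    rw [abs_mul]
    refine mul_le_of_le_one_right (abs_nonneg _) ?_
    have h5 : A n / n ≤ 1 := (div_le_one h4').2 h3
    have h6 : 0 ≤ A n / n := by positivity
    rw [abs_le]; constructor <;> linarith
  have h := (hz0.add hD).add_const r
  rw [add_zero, zero_add] at h
  refine h.congr' ?_
  filter_upwards [eventually_gt_atTop 0] with n hn
  have hn' : (n : ℝ) ≠ 0 := by exact_mod_cast hn.ne'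
  simp only [hz]
  field_simp
  ring

/-- Since `n` exceeds the square of its integer root by at most twice that root, bounded increments
change `M` by `O(√n)` between squares. -/
theorem tendsto_div_of_tendsto_sq {M : ℕ → ℝ} {C : ℝ} (hinc : ∀ n, |M (n + 1) - M n| ≤ C)
    (hsq : Tendsto (fun m : ℕ => M (m ^ 2) / (m : ℝ) ^ 2) atTop (𝓝 0)) :
    Tendsto (fun n : ℕ => M n / n) atTop (𝓝 0) := by
  have hC : 0 ≤ C := (abs_nonneg _).trans (hinc 0)
  have hstep : ∀ n j : ℕ, |M (n + j) - M n| ≤ C * j := by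
    intro n j
    induction j with
    | zero => simp
    | succ j ih =>
      have h := abs_sub_le (M (n + (j + 1))) (M (n + j)) (M n)
      have h2 := hinc (n + j)
      rw [add_assoc] at h2
      push_cast
      linarith
  have hsqrt : Tendsto Nat.sqrt atTop atTop :=
    tendsto_atTop_atTop.2 fun b => ⟨b * b, fun a ha => Nat.le_sqrt.2 ha⟩
  have hlim : Tendsto (fun m : ℕ => |M (m ^ 2) / (m : ℝ) ^ 2| + 2 * C / m) atTop (𝓝 0) := by
    simpa using hsq.abs.add (tendsto_const_div_atTop_nhds_zero_nat (2 * C))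
  refine squeeze_zero_norm' ?_ (hlim.comp hsqrt)
  filter_upwards [eventually_gt_atTop 0] with n hn
  have hm : 0 < Nat.sqrt n := Nat.sqrt_pos.2 hn
  have hm' : (0 : ℝ) < Nat.sqrt n := by exact_mod_cast hm
  have hle : Nat.sqrt n ^ 2 ≤ n := Nat.sqrt_le' n
  obtain ⟨j, hj⟩ := Nat.exists_eq_add_of_le hle
  have hj2 : j ≤ 2 * Nat.sqrt n := by
    have := Nat.sqrt_le_add n
    nlinarith
  have hn' : (0 : ℝ) < n := by exact_mod_cast hn
  have h1 := hstep (Nat.sqrt n ^ 2) j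
  rw [← hj] at h1
  have h2 : |M n| ≤ |M (Nat.sqrt n ^ 2)| + 2 * C * Nat.sqrt n := by
    have h3 := abs_sub_abs_le_abs_sub (M n) (M (Nat.sqrt n ^ 2))
    have h4 : (j : ℝ) ≤ 2 * Nat.sqrt n := by exact_mod_cast hj2
    nlinarith
  have hle' : (Nat.sqrt n : ℝ) ^ 2 ≤ n := by exact_mod_cast hle
  simp only [Function.comp_apply, Real.norm_eq_abs, abs_div, abs_pow, Nat.abs_cast]
  calc |M n| / n ≤ (|M (Nat.sqrt n ^ 2)| + 2 * C * Nat.sqrt n) / n := by gcongr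
    _ ≤ (|M (Nat.sqrt n ^ 2)| + 2 * C * Nat.sqrt n) / (Nat.sqrt n : ℝ) ^ 2 := by gcongr
    _ = _ := by field_simp

/-! ### A strong law of large numbers for countable Markov chains. -/

section Markov

variable {S Ω : Type*} [MeasurableSpace Ω]

/-- The sequence which follows `h` and then remains constant. -/
def extendHistory {n : ℕ} (h : Fin (n + 1) → S) (k : ℕ) : S := h ⟨min k n, by omega⟩

theorem extendHistory_apply {n : ℕ} (g : ℕ → S) {k : ℕ} (hk : k ≤ n) :
    extendHistory (fun i : Fin (n + 1) => g i) k = g k := by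
  simp [extendHistory, min_eq_left hk]

/-- `X` is a time-homogeneous Markov chain with transition probabilities `K` on a discrete
space. -/
structure IsDiscreteMarkov [MeasurableSpace S] (P : Measure Ω) (K : S → S → ℝ)
    (X : ℕ → Ω → S) : Prop where
  measurable : ∀ n, Measurable (X n)
  nonneg : ∀ x y, 0 ≤ K x y
  markov : ∀ n (g : ℕ → S), P {ω | ∀ k ≤ n + 1, X k ω = g k} =
    P {ω | ∀ k ≤ n, X k ω = g k} * ENNReal.ofReal (K (g n) (g (n + 1)))

namespace IsDiscreteMarkov

variable [MeasurableSpace S] {P : Measure Ω} {K : S → S → ℝ} {X : ℕ → Ω → S}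

/-- Finite histories are countably many, and each history ending in a step of probability zero is
null. -/
theorem ae_transition_pos [Countable S] (hX : IsDiscreteMarkov P K X) :
    ∀ᵐ ω ∂P, ∀ n, 0 < K (X n ω) (X (n + 1) ω) := by
  rw [ae_all_iff]
  intro n
  rw [ae_iff]
  refine measure_mono_null (t := ⋃ h : Fin (n + 1 + 1) → S,
    {ω | ¬ 0 < K (X n ω) (X (n + 1) ω) ∧ ∀ k ≤ n + 1, X k ω = extendHistory h k}) ?_ ?_
  · intro ω hω
    exact mem_iUnion.2 ⟨fun i => X i ω, hω, fun k hk =>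
      (extendHistory_apply (fun i => X i ω) hk).symm⟩
  · refine measure_iUnion_null fun h => ?_
    by_cases hpos : 0 < K (extendHistory h n) (extendHistory h (n + 1))
    · convert! measure_empty (μ := P)
      refine eq_empty_of_forall_notMem fun ω hω => hω.1 ?_
      rwa [hω.2 n (Nat.le_succ n), hω.2 (n + 1) le_rfl]
    · refine measure_mono_null (t := {ω | ∀ k ≤ n + 1, X k ω = extendHistory h k})
        (fun ω hω => hω.2) ?_
      rw [hX.markov, ENNReal.ofReal_of_nonpos (not_lt.1 hpos), mul_zero]

variable {ψ : S → S → ℝ} {C : ℝ}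

theorem ae_abs_le [Countable S] (hX : IsDiscreteMarkov P K X) (hψ : ∀ x y, 0 < K x y → |ψ x y| ≤ C) :
    ∀ᵐ ω ∂P, ∀ n, |ψ (X n ω) (X (n + 1) ω)| ≤ C :=
  hX.ae_transition_pos.mono fun _ hω n => hψ _ _ (hω n)

theorem ae_abs_sum_le [Countable S] (hX : IsDiscreteMarkov P K X) (hψ : ∀ x y, 0 < K x y → |ψ x y| ≤ C) :
    ∀ᵐ ω ∂P, ∀ n : ℕ, |∑ i ∈ Finset.range n, ψ (X i ω) (X (i + 1) ω)| ≤ C * n := by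
  filter_upwards [hX.ae_abs_le hψ] with ω hω n
  refine (Finset.abs_sum_le_sum_abs _ _).trans ((Finset.sum_le_sum fun i _ => hω i).trans ?_)
  simp [mul_comm]

variable [DiscreteMeasurableSpace S]

theorem measurableSet_cylinder (hX : IsDiscreteMarkov P K X) (n : ℕ) (g : ℕ → S) :
    MeasurableSet {ω | ∀ k ≤ n, X k ω = g k} := by
  have : {ω | ∀ k ≤ n, X k ω = g k} = ⋂ k, ⋂ (_ : k ≤ n), X k ⁻¹' {g k} := by
    ext; simp
  rw [this]
  exact MeasurableSet.iInter fun k => MeasurableSet.iInter fun _ =>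
    hX.measurable k (MeasurableSet.of_discrete)

variable [Countable S]

theorem measurable_transition (hX : IsDiscreteMarkov P K X) (ψ : S → S → ℝ) (n : ℕ) :
    Measurable fun ω => ψ (X n ω) (X (n + 1) ω) :=
  (Measurable.of_discrete (f := fun q : S × S => ψ q.1 q.2)).comp
    ((hX.measurable n).prodMk (hX.measurable (n + 1)))

theorem measurable_sum (hX : IsDiscreteMarkov P K X) (ψ : S → S → ℝ) (n : ℕ) :
    Measurable fun ω => ∑ i ∈ Finset.range n, ψ (X i ω) (X (i + 1) ω) :=
  Finset.measurable_fun_sum _ fun i _ => hX.measurable_transition ψ i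

variable [IsProbabilityMeasure P]

theorem integrable_transition (hX : IsDiscreteMarkov P K X)
    (hψ : ∀ x y, 0 < K x y → |ψ x y| ≤ C) (n : ℕ) :
    Integrable (fun ω => ψ (X n ω) (X (n + 1) ω)) P :=
  Integrable.of_bound (hX.measurable_transition ψ n).aestronglyMeasurable C
    ((hX.ae_abs_le hψ).mono fun _ hω => hω n)

/-- The conditional mean is zero given a full history: split the cylinder by the next state and
apply the Markov identity to each piece. -/
theorem setIntegral_cylinder_eq_zero (hX : IsDiscreteMarkov P K X)
    (hψ : ∀ x y, 0 < K x y → |ψ x y| ≤ C) (h0 : ∀ x, HasSum (fun y => K x y * ψ x y) 0)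
    (n : ℕ) (g : ℕ → S) :
    ∫ ω in {ω | ∀ k ≤ n, X k ω = g k}, ψ (X n ω) (X (n + 1) ω) ∂P = 0 := by
  set c : Set Ω := {ω | ∀ k ≤ n, X k ω = g k} with hc
  have hcm : MeasurableSet c := hX.measurableSet_cylinder n g
  have hU : c = ⋃ y, c ∩ X (n + 1) ⁻¹' {y} := by
    ext ω; simp
  have hsm : ∀ y, MeasurableSet (c ∩ X (n + 1) ⁻¹' {y}) := fun y =>
    hcm.inter (hX.measurable (n + 1) MeasurableSet.of_discrete)
  have hsum := hasSum_integral_iUnion (μ := P) (f := fun ω => ψ (X n ω) (X (n + 1) ω)) hsm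
    (fun y y' hyy => disjoint_left.2 fun ω hω hω' => hyy (hω.2.symm.trans hω'.2))
    (hX.integrable_transition hψ n).integrableOn
  rw [← hU] at hsum
  have hval : ∀ y, ∫ ω in c ∩ X (n + 1) ⁻¹' {y}, ψ (X n ω) (X (n + 1) ω) ∂P =
      P.real c * (K (g n) y * ψ (g n) y) := by
    intro y
    have e1 : ∫ ω in c ∩ X (n + 1) ⁻¹' {y}, ψ (X n ω) (X (n + 1) ω) ∂P =
        ∫ ω in c ∩ X (n + 1) ⁻¹' {y}, ψ (g n) y ∂P := by
      refine setIntegral_congr_fun (hsm y) fun ω hω => ?_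
      have h1 : X n ω = g n := hω.1 n le_rfl
      have h2 : X (n + 1) ω = y := hω.2
      simp only [h1, h2]
    have e2 : P (c ∩ X (n + 1) ⁻¹' {y}) = P c * ENNReal.ofReal (K (g n) y) := by
      -- The prescribed path follows `g` up to time `n` and is at `y` at time `n + 1`.
      have h := hX.markov n (fun k => if k ≤ n then g k else y)
      have h1 : {ω | ∀ k ≤ n + 1, X k ω = if k ≤ n then g k else y} =
          c ∩ X (n + 1) ⁻¹' {y} := by
        ext ω
        simp only [hc, mem_ofPred_eq, mem_inter_iff, mem_preimage, mem_singleton_iff]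
        refine ⟨fun H => ⟨fun k hk => ?_, ?_⟩, fun H k hk => ?_⟩
        · simpa [hk] using H k (hk.trans (Nat.le_succ n))
        · simpa using H (n + 1) le_rfl
        · rcases Nat.le_succ_iff.1 hk with hk | rfl
          · simpa [hk] using H.1 k hk
          · simpa using H.2
      have h2 : {ω | ∀ k ≤ n, X k ω = if k ≤ n then g k else y} = c := by
        ext ω
        simp only [hc, mem_ofPred_eq]
        exact forall₂_congr fun k hk => by simp [hk]
      rw [h1, h2] at h
      simpa using h
    rw [e1, setIntegral_const, smul_eq_mul, measureReal_def, measureReal_def, e2,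
      ENNReal.toReal_mul, ENNReal.toReal_ofReal (hX.nonneg _ _), mul_assoc]
  simp only [hval] at hsum
  exact hsum.unique (by simpa using (h0 (g n)).mul_left (P.real c))

theorem integrable_sum_mul (hX : IsDiscreteMarkov P K X)
    (hψ : ∀ x y, 0 < K x y → |ψ x y| ≤ C) (n : ℕ) :
    Integrable (fun ω => (∑ i ∈ Finset.range n, ψ (X i ω) (X (i + 1) ω)) *
      ψ (X n ω) (X (n + 1) ω)) P := by
  refine Integrable.of_bound ((hX.measurable_sum ψ n).mul
    (hX.measurable_transition ψ n)).aestronglyMeasurable (C * n * C) ?_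
  filter_upwards [hX.ae_abs_le hψ, hX.ae_abs_sum_le hψ] with ω h1 h2
  rw [Real.norm_eq_abs, abs_mul]
  exact mul_le_mul (h2 n) (h1 n) (abs_nonneg _) ((abs_nonneg _).trans (h2 n))

/-- Orthogonality of martingale differences: on each history cylinder the past sum is constant and
the next increment integrates to zero. -/
theorem integral_sum_mul_eq_zero (hX : IsDiscreteMarkov P K X)
    (hψ : ∀ x y, 0 < K x y → |ψ x y| ≤ C) (h0 : ∀ x, HasSum (fun y => K x y * ψ x y) 0) (n : ℕ) :
    ∫ ω, (∑ i ∈ Finset.range n, ψ (X i ω) (X (i + 1) ω)) * ψ (X n ω) (X (n + 1) ω) ∂P = 0 := by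
  set s : (Fin (n + 1) → S) → Set Ω := fun h => {ω | ∀ k ≤ n, X k ω = extendHistory h k} with hs
  have hU : (⋃ h, s h) = univ := eq_univ_of_forall fun ω => mem_iUnion.2
    ⟨fun i => X i ω, fun k hk => (extendHistory_apply (fun i => X i ω) hk).symm⟩
  have hdisj : Pairwise (Function.onFun Disjoint s) := by
    refine fun h h' hne => disjoint_left.2 fun ω hω hω' => hne (funext fun i => ?_)
    have e := (hω i (Nat.lt_succ_iff.1 i.2)).symm.trans (hω' i (Nat.lt_succ_iff.1 i.2))
    simpa [extendHistory, min_eq_left (Nat.lt_succ_iff.1 i.2)] using e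
  have hsum := hasSum_integral_iUnion (μ := P) (fun h => hX.measurableSet_cylinder n _) hdisj
    (hX.integrable_sum_mul hψ n).integrableOn
  rw [hU, setIntegral_univ] at hsum
  refine hsum.unique ?_
  have hz : ∀ h, ∫ ω in s h, (∑ i ∈ Finset.range n, ψ (X i ω) (X (i + 1) ω)) *
      ψ (X n ω) (X (n + 1) ω) ∂P = 0 := by
    intro h
    have e : ∫ ω in s h, (∑ i ∈ Finset.range n, ψ (X i ω) (X (i + 1) ω)) *
        ψ (X n ω) (X (n + 1) ω) ∂P = ∫ ω in s h, (∑ i ∈ Finset.range n,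
          ψ (extendHistory h i) (extendHistory h (i + 1))) * ψ (X n ω) (X (n + 1) ω) ∂P := by
      refine setIntegral_congr_fun (hX.measurableSet_cylinder n _) fun ω hω => ?_
      have hω' : ∀ k ≤ n, X k ω = extendHistory h k := hω
      congr 1
      refine Finset.sum_congr rfl fun i hi => ?_
      have hi' := Finset.mem_range.1 hi
      rw [hω' i hi'.le, hω' (i + 1) hi']
    rw [e, integral_const_mul, hX.setIntegral_cylinder_eq_zero hψ h0, mul_zero]
  rw [show (fun h => ∫ ω in {ω | ∀ k ≤ n, X k ω = extendHistory h k},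
    (∑ i ∈ Finset.range n, ψ (X i ω) (X (i + 1) ω)) * ψ (X n ω) (X (n + 1) ω) ∂P) =
    fun _ => 0 from funext hz]
  exact hasSum_zero

theorem integral_sum_sq_le (hX : IsDiscreteMarkov P K X)
    (hψ : ∀ x y, 0 < K x y → |ψ x y| ≤ C) (h0 : ∀ x, HasSum (fun y => K x y * ψ x y) 0) (n : ℕ) :
    Integrable (fun ω => (∑ i ∈ Finset.range n, ψ (X i ω) (X (i + 1) ω)) ^ 2) P ∧
    ∫ ω, (∑ i ∈ Finset.range n, ψ (X i ω) (X (i + 1) ω)) ^ 2 ∂P ≤ C ^ 2 * n := by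
  induction n with
  | zero => simp
  | succ n ih =>
    have hsq : Integrable (fun ω => ψ (X n ω) (X (n + 1) ω) ^ 2) P := by
      refine Integrable.of_bound
        ((hX.measurable_transition ψ n).pow_const 2).aestronglyMeasurable (C ^ 2) ?_
      filter_upwards [hX.ae_abs_le hψ] with ω h1
      rw [Real.norm_eq_abs, abs_pow]
      exact pow_le_pow_left₀ (abs_nonneg _) (h1 n) 2
    have hsq_le : ∫ ω, ψ (X n ω) (X (n + 1) ω) ^ 2 ∂P ≤ C ^ 2 := by
      have h := integral_mono_ae hsq (integrable_const (C ^ 2)) (by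
        filter_upwards [hX.ae_abs_le hψ] with ω h1
        exact sq_le_sq' (by linarith [(abs_le.1 (h1 n)).1]) (abs_le.1 (h1 n)).2)
      simpa using h
    have hcross := (hX.integrable_sum_mul hψ n).const_mul 2
    have e : (fun ω => (∑ i ∈ Finset.range (n + 1), ψ (X i ω) (X (i + 1) ω)) ^ 2) =
        fun ω => (∑ i ∈ Finset.range n, ψ (X i ω) (X (i + 1) ω)) ^ 2 +
          2 * ((∑ i ∈ Finset.range n, ψ (X i ω) (X (i + 1) ω)) * ψ (X n ω) (X (n + 1) ω)) +
          ψ (X n ω) (X (n + 1) ω) ^ 2 := by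
      funext ω
      rw [Finset.sum_range_succ]; ring
    rw [e]
    refine ⟨(ih.1.add hcross).add hsq, ?_⟩
    rw [integral_add (by exact ih.1.add hcross) hsq, integral_add ih.1 hcross, integral_const_mul,
      hX.integral_sum_mul_eq_zero hψ h0 n]
    push_cast
    linarith [ih.2]

/-- The strong law of large numbers for the bounded martingale differences
`ψ (X i) (X (i + 1))`. -/
theorem ae_tendsto_sum_div (hX : IsDiscreteMarkov P K X)
    (hψ : ∀ x y, 0 < K x y → |ψ x y| ≤ C) (h0 : ∀ x, HasSum (fun y => K x y * ψ x y) 0) :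
    ∀ᵐ ω ∂P, Tendsto (fun n : ℕ => (∑ i ∈ Finset.range n, ψ (X i ω) (X (i + 1) ω)) / n) atTop
      (𝓝 0) := by
  set M : ℕ → Ω → ℝ := fun n ω => ∑ i ∈ Finset.range n, ψ (X i ω) (X (i + 1) ω) with hM
  -- Along squares the normalised second moments are at most `C² / (m + 1)²`. Their sum is finite,
  -- so the squares are almost surely summable and tend to zero; bounded increments fill the gaps.
  set f : ℕ → Ω → ENNReal := fun m ω =>
    ENNReal.ofReal ((M ((m + 1) ^ 2) ω / ((m + 1 : ℕ) : ℝ) ^ 2) ^ 2) with hf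
  have hfm : ∀ m, Measurable (f m) := fun m =>
    (((hX.measurable_sum ψ _).div_const _).pow_const 2).ennreal_ofReal
  have hfi : ∀ m, ∫⁻ ω, f m ω ∂P ≤ ENNReal.ofReal (C ^ 2 * (1 / ((m : ℝ) + 1) ^ 2)) := by
    intro m
    obtain ⟨hi, hle⟩ := hX.integral_sum_sq_le hψ h0 ((m + 1) ^ 2)
    have hi' : Integrable (fun ω => (M ((m + 1) ^ 2) ω / ((m + 1 : ℕ) : ℝ) ^ 2) ^ 2) P := by
      simpa only [div_pow] using hi.div_const ((((m + 1 : ℕ) : ℝ) ^ 2) ^ 2)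
    rw [← ofReal_integral_eq_lintegral_ofReal hi' (ae_of_all _ fun ω => sq_nonneg _)]
    refine ENNReal.ofReal_le_ofReal ?_
    simp only [div_pow]
    rw [integral_div, div_le_iff₀ (by positivity)]
    refine hle.trans (le_of_eq ?_)
    push_cast
    field_simp
  have hsum : Summable fun m : ℕ => C ^ 2 * (1 / ((m : ℝ) + 1) ^ 2) := by
    refine Summable.mul_left _ ?_
    have h := (summable_nat_add_iff 1).2 (Real.summable_one_div_nat_pow.2 one_lt_two)
    simpa using h
  have hfin : ∫⁻ ω, ∑' m, f m ω ∂P ≠ ⊤ := by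
    rw [lintegral_tsum fun m => (hfm m).aemeasurable]
    exact ne_top_of_le_ne_top hsum.tsum_ofReal_ne_top (ENNReal.tsum_le_tsum hfi)
  filter_upwards [ae_lt_top (Measurable.tsum hfm) hfin, hX.ae_abs_le hψ] with ω hω hb
  refine tendsto_div_of_tendsto_sq (M := fun n => M n ω) (C := C) (fun n => ?_) ?_
  · simp only [hM, Finset.sum_range_succ, add_sub_cancel_left]
    exact hb n
  · rw [← tendsto_add_atTop_iff_nat 1]
    have h1 := (ENNReal.tendsto_toReal ENNReal.zero_ne_top).comp
      (ENNReal.tendsto_atTop_zero_of_tsum_ne_top hω.ne)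
    have h2 : Tendsto (fun m : ℕ => (M ((m + 1) ^ 2) ω / ((m + 1 : ℕ) : ℝ) ^ 2) ^ 2) atTop
        (𝓝 0) := by
      refine h1.congr fun m => ?_
      simp only [Function.comp_apply, hf]
      exact ENNReal.toReal_ofReal (sq_nonneg _)
    have h3 := h2.sqrt
    simp only [Real.sqrt_sq_eq_abs, Real.sqrt_zero] at h3
    exact (tendsto_zero_iff_abs_tendsto_zero _).2 h3

end IsDiscreteMarkov

end Markov

/-! ### Effect of one step on degree sums, and the drift. -/

namespace DiMultigraph

instance : DiscreteMeasurableSpace DiMultigraph := ⟨fun _ => trivial⟩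

instance : Countable DiMultigraph :=
  Function.Injective.countable (f := fun G : DiMultigraph => (G.numNodes, G.edges))
    fun _ _ h => DiMultigraph.ext (congrArg Prod.fst h) (congrArg Prod.snd h)

variable (G : DiMultigraph)

theorem inDegree_addNodeTo (v : Fin G.numNodes) (u : ℕ) :
    (G.addNodeTo v).inDegree u = G.inDegree u + if (v : ℕ) = u then 1 else 0 := by
  simp [inDegree, addNodeTo, List.countP_cons]

theorem outDegree_addNodeTo (v : Fin G.numNodes) (u : ℕ) :
    (G.addNodeTo v).outDegree u = G.outDegree u + if G.numNodes = u then 1 else 0 := by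
  simp [outDegree, addNodeTo, List.countP_cons]

theorem inDegree_addNodeFrom (v : Fin G.numNodes) (u : ℕ) :
    (G.addNodeFrom v).inDegree u = G.inDegree u + if G.numNodes = u then 1 else 0 := by
  simp [inDegree, addNodeFrom, List.countP_cons]

theorem outDegree_addNodeFrom (v : Fin G.numNodes) (u : ℕ) :
    (G.addNodeFrom v).outDegree u = G.outDegree u + if (v : ℕ) = u then 1 else 0 := by
  simp [outDegree, addNodeFrom, List.countP_cons]

theorem inDegree_addEdge (v w : Fin G.numNodes) (u : ℕ) :
    (G.addEdge v w).inDegree u = G.inDegree u + if (w : ℕ) = u then 1 else 0 := by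
  simp [inDegree, addEdge, List.countP_cons]

theorem outDegree_addEdge (v w : Fin G.numNodes) (u : ℕ) :
    (G.addEdge v w).outDegree u = G.outDegree u + if (v : ℕ) = u then 1 else 0 := by
  simp [outDegree, addEdge, List.countP_cons]

theorem inDegree_numNodes : G.inDegree G.numNodes = 0 :=
  List.countP_eq_zero.2 fun e he => by simpa using (G.valid e he).2.ne

theorem outDegree_numNodes : G.outDegree G.numNodes = 0 :=
  List.countP_eq_zero.2 fun e he => by simpa using (G.valid e he).1.ne

theorem sum_countP_eq_length {N : ℕ} (f : ℕ × ℕ → ℕ) (l : List (ℕ × ℕ)) (h : ∀ e ∈ l, f e < N) :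
    ∑ v : Fin N, l.countP (fun e => decide (f e = v)) = l.length := by
  induction l with
  | nil => simp
  | cons e l ih =>
    have he : f e < N := h e (List.mem_cons_self)
    have h1 : ∑ v : Fin N, (if f e = (v : ℕ) then 1 else 0) = 1 := by
      rw [Finset.sum_eq_single (⟨f e, he⟩ : Fin N)]
      · simp
      · intro v _ hv
        rw [if_neg fun h => hv (Fin.ext h.symm)]
      · simp
    simp only [List.countP_cons, Finset.sum_add_distrib, decide_eq_true_eq, List.length_cons]
    rw [ih fun e he => h e (List.mem_cons_of_mem _ he), h1]

theorem sum_inDegree : ∑ v : Fin G.numNodes, G.inDegree v = G.numEdges :=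
  sum_countP_eq_length Prod.snd G.edges fun e he => (G.valid e he).2

theorem sum_outDegree : ∑ v : Fin G.numNodes, G.outDegree v = G.numEdges :=
  sum_countP_eq_length Prod.fst G.edges fun e he => (G.valid e he).1

section Choice

variable {lam : ℝ}

theorem inChoice_nonneg (hlam : 0 < lam) (v : Fin G.numNodes) : 0 ≤ inChoice lam G v := by
  unfold inChoice; positivity

theorem outChoice_nonneg (hlam : 0 < lam) (v : Fin G.numNodes) : 0 ≤ outChoice lam G v := by
  unfold outChoice; positivity

theorem sum_inChoice (hlam : 0 < lam) (hN : 0 < G.numNodes) : ∑ v, inChoice lam G v = 1 := by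
  have hN' : (0 : ℝ) < G.numNodes := by exact_mod_cast hN
  have h : (∑ v : Fin G.numNodes, (G.inDegree v : ℝ)) = G.numEdges := by
    exact_mod_cast G.sum_inDegree
  simp only [inChoice]
  rw [← Finset.sum_div, Finset.sum_add_distrib, h]
  simp only [Finset.sum_const, Finset.card_univ, Fintype.card_fin, nsmul_eq_mul]
  rw [mul_comm lam]
  exact div_self (by positivity)

theorem sum_outChoice (hlam : 0 < lam) (hN : 0 < G.numNodes) : ∑ v, outChoice lam G v = 1 := by
  have hN' : (0 : ℝ) < G.numNodes := by exact_mod_cast hN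
  have h : (∑ v : Fin G.numNodes, (G.outDegree v : ℝ)) = G.numEdges := by
    exact_mod_cast G.sum_outDegree
  simp only [outChoice]
  rw [← Finset.sum_div, Finset.sum_add_distrib, h]
  simp only [Finset.sum_const, Finset.card_univ, Fintype.card_fin, nsmul_eq_mul]
  rw [mul_comm lam]
  exact div_self (by positivity)

end Choice

/-- The sum over all nodes of a function of in-degree and out-degree. -/
def degreeSum (φ : ℕ → ℕ → ℝ) : ℝ := ∑ v : Fin G.numNodes, φ (G.inDegree v) (G.outDegree v)

/-- The change of `φ` at `v` when its in-degree grows by one. -/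
def inDiff (φ : ℕ → ℕ → ℝ) (v : Fin G.numNodes) : ℝ :=
  φ (G.inDegree v + 1) (G.outDegree v) - φ (G.inDegree v) (G.outDegree v)

/-- The change of `φ` at `v` when its out-degree grows by one. -/
def outDiff (φ : ℕ → ℕ → ℝ) (v : Fin G.numNodes) : ℝ :=
  φ (G.inDegree v) (G.outDegree v + 1) - φ (G.inDegree v) (G.outDegree v)

/-- The mixed second difference of `φ` at `v`. -/
def mixedDiff (φ : ℕ → ℕ → ℝ) (v : Fin G.numNodes) : ℝ :=
  φ (G.inDegree v + 1) (G.outDegree v + 1) - φ (G.inDegree v + 1) (G.outDegree v)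
    - φ (G.inDegree v) (G.outDegree v + 1) + φ (G.inDegree v) (G.outDegree v)

theorem degreeSum_addNodeTo (φ : ℕ → ℕ → ℝ) (v : Fin G.numNodes) :
    (G.addNodeTo v).degreeSum φ = G.degreeSum φ + (φ 0 1 + G.inDiff φ v) := by
  have hsum : (G.addNodeTo v).degreeSum φ = ∑ u : Fin (G.numNodes + 1),
      φ ((G.addNodeTo v).inDegree u) ((G.addNodeTo v).outDegree u) := rfl
  have hterm : ∀ u : Fin G.numNodes,
      φ ((G.addNodeTo v).inDegree u) ((G.addNodeTo v).outDegree u) =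
        φ (G.inDegree u) (G.outDegree u) + if v = u then G.inDiff φ u else 0 := by
    intro u
    rw [inDegree_addNodeTo, outDegree_addNodeTo, if_neg u.2.ne']
    by_cases h : v = u
    · subst h; simp [inDiff]
    · rw [if_neg h, if_neg fun h' => h (Fin.ext h')]; simp
  rw [hsum, Fin.sum_univ_castSucc]
  simp only [Fin.val_castSucc, Fin.val_last, hterm, Finset.sum_add_distrib, Finset.sum_ite_eq,
    Finset.mem_univ, if_true]
  rw [inDegree_addNodeTo, outDegree_addNodeTo, if_neg v.2.ne, if_pos rfl, inDegree_numNodes,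
    outDegree_numNodes]
  simp only [degreeSum]
  ring

theorem degreeSum_addNodeFrom (φ : ℕ → ℕ → ℝ) (v : Fin G.numNodes) :
    (G.addNodeFrom v).degreeSum φ = G.degreeSum φ + (φ 1 0 + G.outDiff φ v) := by
  have hsum : (G.addNodeFrom v).degreeSum φ = ∑ u : Fin (G.numNodes + 1),
      φ ((G.addNodeFrom v).inDegree u) ((G.addNodeFrom v).outDegree u) := rfl
  have hterm : ∀ u : Fin G.numNodes,
      φ ((G.addNodeFrom v).inDegree u) ((G.addNodeFrom v).outDegree u) =
        φ (G.inDegree u) (G.outDegree u) + if v = u then G.outDiff φ u else 0 := by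
    intro u
    rw [inDegree_addNodeFrom, outDegree_addNodeFrom, if_neg u.2.ne']
    by_cases h : v = u
    · subst h; simp [outDiff]
    · rw [if_neg h, if_neg fun h' => h (Fin.ext h')]; simp
  rw [hsum, Fin.sum_univ_castSucc]
  simp only [Fin.val_castSucc, Fin.val_last, hterm, Finset.sum_add_distrib, Finset.sum_ite_eq,
    Finset.mem_univ, if_true]
  rw [inDegree_addNodeFrom, outDegree_addNodeFrom, if_neg v.2.ne, if_pos rfl, inDegree_numNodes,
    outDegree_numNodes]
  simp only [degreeSum]
  ring

/-- The two endpoints contribute separately unless the edge is a loop, when both degrees of one node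
grow at once and the mixed difference corrects the sum. -/
theorem degreeSum_addEdge (φ : ℕ → ℕ → ℝ) (v w : Fin G.numNodes) :
    (G.addEdge v w).degreeSum φ = G.degreeSum φ +
      (G.outDiff φ v + G.inDiff φ w + if v = w then G.mixedDiff φ v else 0) := by
  have hsum : (G.addEdge v w).degreeSum φ = ∑ u : Fin G.numNodes,
      φ ((G.addEdge v w).inDegree u) ((G.addEdge v w).outDegree u) := rfl
  have hterm : ∀ u : Fin G.numNodes,
      φ ((G.addEdge v w).inDegree u) ((G.addEdge v w).outDegree u) =
        φ (G.inDegree u) (G.outDegree u) + (if v = u then G.outDiff φ u else 0) +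
          (if w = u then G.inDiff φ u else 0) +
          (if v = u then (if u = w then G.mixedDiff φ u else 0) else 0) := by
    intro u
    rw [inDegree_addEdge, outDegree_addEdge]
    simp only [Fin.val_inj]
    by_cases h : v = u
    · by_cases h' : w = u
      · subst h; subst h'; simp [inDiff, outDiff, mixedDiff]; ring
      · have h'' : u ≠ w := fun e => h' e.symm
        simp [h, h', h'', outDiff]
    · by_cases h' : w = u
      · simp [h, h', inDiff]
      · simp [h, h']
  rw [hsum]
  simp only [hterm, Finset.sum_add_distrib, Finset.sum_ite_eq, Finset.mem_univ, if_true]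
  simp only [degreeSum]
  ring

section Step

variable {α β γ lam mu : ℝ}

theorem stepProb_nonneg (hα : 0 < α) (hβ : 0 < β) (hγ : 0 < γ) (hlam : 0 < lam) (hmu : 0 < mu)
    (G G' : DiMultigraph) : 0 ≤ stepProb α β γ lam mu G G' := by
  have h1 := fun v => inChoice_nonneg G hlam v
  have h2 := fun v => outChoice_nonneg G hmu v
  unfold stepProb
  refine add_nonneg (add_nonneg (mul_nonneg hα.le (Finset.sum_nonneg fun v _ => ?_))
    (mul_nonneg hβ.le (Finset.sum_nonneg fun v _ => Finset.sum_nonneg fun w _ => ?_)))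
    (mul_nonneg hγ.le (Finset.sum_nonneg fun v _ => ?_))
  · split_ifs; exacts [h1 v, le_rfl]
  · split_ifs; exacts [mul_nonneg (h2 v) (h1 w), le_rfl]
  · split_ifs; exacts [h2 v, le_rfl]

theorem cases_of_stepProb_pos {G G' : DiMultigraph} (h : 0 < stepProb α β γ lam mu G G') :
    (∃ v, G' = G.addNodeTo v) ∨ (∃ v w, G' = G.addEdge v w) ∨ ∃ v, G' = G.addNodeFrom v := by
  by_contra! hcon
  obtain ⟨h1, h2, h3⟩ := hcon
  refine h.ne' ?_
  unfold stepProb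
  simp [fun v => (h1 v).symm, fun v w => (h2 v w).symm, fun v => (h3 v).symm]

theorem numEdges_of_stepProb_pos {G G' : DiMultigraph} (h : 0 < stepProb α β γ lam mu G G') :
    G'.numEdges = G.numEdges + 1 := by
  rcases cases_of_stepProb_pos h with ⟨v, rfl⟩ | ⟨v, w, rfl⟩ | ⟨v, rfl⟩ <;> rfl

/-- A row of transition probabilities is a finite combination of point masses, one for each choice
of nodes; choices leading to the same graph simply add. -/
theorem hasSum_stepProb_mul (G : DiMultigraph) (ψ : DiMultigraph → ℝ) :
    HasSum (fun G' => stepProb α β γ lam mu G G' * ψ G')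
      (α * (∑ v, inChoice lam G v * ψ (G.addNodeTo v)) +
        β * (∑ v, ∑ w, outChoice mu G v * inChoice lam G w * ψ (G.addEdge v w)) +
        γ * (∑ v, outChoice mu G v * ψ (G.addNodeFrom v))) := by
  classical
  have hone : ∀ (H : DiMultigraph) (c : ℝ),
      HasSum (fun G' => (if H = G' then c else 0) * ψ G') (c * ψ H) := by
    intro H c
    have h := hasSum_single (f := fun G' => (if H = G' then c else 0) * ψ G') H
      (fun G' hG' => by simp [hG'.symm])
    simpa using h
  have h1 := hasSum_sum (s := Finset.univ) fun v _ => hone (G.addNodeTo v) (inChoice lam G v)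
  have h2 := hasSum_sum (s := Finset.univ) fun v _ => hasSum_sum (s := Finset.univ) fun w _ =>
    hone (G.addEdge v w) (outChoice mu G v * inChoice lam G w)
  have h3 := hasSum_sum (s := Finset.univ) fun v _ => hone (G.addNodeFrom v) (outChoice mu G v)
  refine (((h1.mul_left α).add (h2.mul_left β)).add (h3.mul_left γ)).congr_fun ?_
  intro G'
  unfold stepProb
  simp only [← Finset.sum_mul, add_mul, mul_assoc]

/-- The conditional mean increment of `degreeSum φ` in one step. -/
def drift (α β γ lam mu : ℝ) (φ : ℕ → ℕ → ℝ) (G : DiMultigraph) : ℝ :=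
  α * φ 0 1 + γ * φ 1 0 + (α + β) * (∑ v, inChoice lam G v * G.inDiff φ v) +
    (β + γ) * (∑ v, outChoice mu G v * G.outDiff φ v) +
    β * (∑ v, outChoice mu G v * inChoice lam G v * G.mixedDiff φ v)

theorem hasSum_stepProb_centered (hlam : 0 < lam) (hmu : 0 < mu) (hsum : α + β + γ = 1)
    (φ : ℕ → ℕ → ℝ) (G : DiMultigraph) :
    HasSum (fun G' => stepProb α β γ lam mu G G' *
      (G'.degreeSum φ - G.degreeSum φ - drift α β γ lam mu φ G)) 0 := by
  have h := hasSum_stepProb_mul (α := α) (β := β) (γ := γ) (lam := lam) (mu := mu) G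
    (fun G' => G'.degreeSum φ - G.degreeSum φ - drift α β γ lam mu φ G)
  convert! h using 1
  -- Without nodes every sum is empty; otherwise the choice probabilities sum to one.
  rcases Nat.eq_zero_or_pos G.numNodes with h0 | hN
  · have : IsEmpty (Fin G.numNodes) := by rw [h0]; infer_instance
    simp
  · have s1 := sum_inChoice G hlam hN
    have s2 := sum_outChoice G hmu hN
    simp only [degreeSum_addNodeTo, degreeSum_addNodeFrom, degreeSum_addEdge, add_sub_cancel_left]
    set d := drift α β γ lam mu φ G with hd
    have e1 : ∑ v, inChoice lam G v * (φ 0 1 + G.inDiff φ v - d) =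
        φ 0 1 - d + ∑ v, inChoice lam G v * G.inDiff φ v := by
      have : ∀ v, inChoice lam G v * (φ 0 1 + G.inDiff φ v - d) =
        inChoice lam G v * (φ 0 1 - d) + inChoice lam G v * G.inDiff φ v := fun v => by ring
      simp only [this, Finset.sum_add_distrib, ← Finset.sum_mul, s1, one_mul]
    have e3 : ∑ v, outChoice mu G v * (φ 1 0 + G.outDiff φ v - d) =
        φ 1 0 - d + ∑ v, outChoice mu G v * G.outDiff φ v := by
      have : ∀ v, outChoice mu G v * (φ 1 0 + G.outDiff φ v - d) =
        outChoice mu G v * (φ 1 0 - d) + outChoice mu G v * G.outDiff φ v := fun v => by ring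
      simp only [this, Finset.sum_add_distrib, ← Finset.sum_mul, s2, one_mul]
    have e2 : ∑ v, ∑ w, outChoice mu G v * inChoice lam G w *
        (G.outDiff φ v + G.inDiff φ w + (if v = w then G.mixedDiff φ v else 0) - d) =
        ∑ v, outChoice mu G v * G.outDiff φ v + ∑ v, inChoice lam G v * G.inDiff φ v +
          ∑ v, outChoice mu G v * inChoice lam G v * G.mixedDiff φ v - d := by
      have : ∀ v w, outChoice mu G v * inChoice lam G w *
        (G.outDiff φ v + G.inDiff φ w + (if v = w then G.mixedDiff φ v else 0) - d) =
        inChoice lam G w * (outChoice mu G v * (G.outDiff φ v - d)) +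
        outChoice mu G v * (inChoice lam G w * G.inDiff φ w) +
        (if v = w then outChoice mu G v * inChoice lam G w * G.mixedDiff φ v else 0) := by
        intro v w; split_ifs <;> ring
      simp only [this, Finset.sum_add_distrib, ← Finset.sum_mul, ← Finset.mul_sum, s1, s2,
        one_mul, Finset.sum_ite_eq, Finset.mem_univ, if_true]
      have : ∀ v, outChoice mu G v * (G.outDiff φ v - d) =
        outChoice mu G v * G.outDiff φ v - outChoice mu G v * d := fun v => by ring
      simp only [this, Finset.sum_sub_distrib, ← Finset.sum_mul, s2]
      ring
    rw [e1, e2, e3]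
    have hd' := hd
    unfold drift at hd'
    linear_combination hd' + d * hsum

theorem abs_inDiff_le {φ : ℕ → ℕ → ℝ} (hφ : ∀ a b, |φ a b| ≤ 1) (v : Fin G.numNodes) :
    |G.inDiff φ v| ≤ 2 := by
  have h1 := abs_le.1 (hφ (G.inDegree v + 1) (G.outDegree v))
  have h2 := abs_le.1 (hφ (G.inDegree v) (G.outDegree v))
  unfold inDiff
  rw [abs_le]; constructor <;> linarith

theorem abs_outDiff_le {φ : ℕ → ℕ → ℝ} (hφ : ∀ a b, |φ a b| ≤ 1) (v : Fin G.numNodes) :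
    |G.outDiff φ v| ≤ 2 := by
  have h1 := abs_le.1 (hφ (G.inDegree v) (G.outDegree v + 1))
  have h2 := abs_le.1 (hφ (G.inDegree v) (G.outDegree v))
  unfold outDiff
  rw [abs_le]; constructor <;> linarith

theorem abs_mixedDiff_le {φ : ℕ → ℕ → ℝ} (hφ : ∀ a b, |φ a b| ≤ 1) (v : Fin G.numNodes) :
    |G.mixedDiff φ v| ≤ 4 := by
  have h1 := abs_le.1 (hφ (G.inDegree v + 1) (G.outDegree v + 1))
  have h2 := abs_le.1 (hφ (G.inDegree v) (G.outDegree v))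
  have h3 := abs_le.1 (hφ (G.inDegree v) (G.outDegree v + 1))
  have h4 := abs_le.1 (hφ (G.inDegree v + 1) (G.outDegree v))
  unfold mixedDiff
  rw [abs_le]; constructor <;> linarith

theorem abs_degreeSum_sub_le {φ : ℕ → ℕ → ℝ} (hφ : ∀ a b, |φ a b| ≤ 1) {G G' : DiMultigraph}
    (h : 0 < stepProb α β γ lam mu G G') : |G'.degreeSum φ - G.degreeSum φ| ≤ 8 := by
  rcases cases_of_stepProb_pos h with ⟨v, rfl⟩ | ⟨v, w, rfl⟩ | ⟨v, rfl⟩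
  · rw [degreeSum_addNodeTo, add_sub_cancel_left]
    linarith [abs_add_le (φ 0 1) (G.inDiff φ v), hφ 0 1, G.abs_inDiff_le hφ v]
  · rw [degreeSum_addEdge, add_sub_cancel_left]
    have h1 : |if v = w then G.mixedDiff φ v else 0| ≤ 4 := by
      split_ifs
      · exact G.abs_mixedDiff_le hφ v
      · simp
    linarith [abs_add_le (G.outDiff φ v + G.inDiff φ w) (if v = w then G.mixedDiff φ v else 0),
      abs_add_le (G.outDiff φ v) (G.inDiff φ w), G.abs_inDiff_le hφ w, G.abs_outDiff_le hφ v]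
  · rw [degreeSum_addNodeFrom, add_sub_cancel_left]
    linarith [abs_add_le (φ 1 0) (G.outDiff φ v), hφ 1 0, G.abs_outDiff_le hφ v]

theorem abs_sum_weight_mul_le {ι : Type*} [Fintype ι] {w f : ι → ℝ} {C : ℝ} (hw : ∀ i, 0 ≤ w i)
    (hw1 : ∑ i, w i = 1) (hf : ∀ i, |f i| ≤ C) : |∑ i, w i * f i| ≤ C := by
  refine (Finset.abs_sum_le_sum_abs _ _).trans ?_
  calc ∑ i, |w i * f i| ≤ ∑ i, w i * C := Finset.sum_le_sum fun i _ => by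
        rw [abs_mul, abs_of_nonneg (hw i)]
        exact mul_le_mul_of_nonneg_left (hf i) (hw i)
    _ = C := by rw [← Finset.sum_mul, hw1, one_mul]

theorem abs_centered_le (hα : 0 < α) (hβ : 0 < β) (hγ : 0 < γ) (hlam : 0 < lam) (hmu : 0 < mu)
    (hsum : α + β + γ = 1)
    {φ : ℕ → ℕ → ℝ} (hφ : ∀ a b, |φ a b| ≤ 1) (G G' : DiMultigraph)
    (h : 0 < stepProb α β γ lam mu G G') :
    |G'.degreeSum φ - G.degreeSum φ - drift α β γ lam mu φ G| ≤ 18 := by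
  have hN : 0 < G.numNodes := by
    rcases cases_of_stepProb_pos h with ⟨v, -⟩ | ⟨v, -⟩ | ⟨v, -⟩ <;> exact v.pos
  have s1 := sum_inChoice G hlam hN
  have s2 := sum_outChoice G hmu hN
  have n1 := fun v => inChoice_nonneg G hlam v
  have n2 := fun v => outChoice_nonneg G hmu v
  have b1 := abs_le.1 (abs_sum_weight_mul_le n1 s1 (G.abs_inDiff_le hφ))
  have b2 := abs_le.1 (abs_sum_weight_mul_le n2 s2 (G.abs_outDiff_le hφ))
  have b3 : |∑ v, outChoice mu G v * (inChoice lam G v * G.mixedDiff φ v)| ≤ 4 := by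
    refine abs_sum_weight_mul_le n2 s2 fun v => ?_
    have hle : inChoice lam G v ≤ 1 := by
      rw [← s1]
      exact Finset.single_le_sum (fun u _ => n1 u) (Finset.mem_univ v)
    rw [abs_mul, abs_of_nonneg (n1 v)]
    exact (mul_le_of_le_one_left (abs_nonneg _) hle).trans (G.abs_mixedDiff_le hφ v)
  simp only [← mul_assoc] at b3
  have b3 := abs_le.1 b3
  have b4 := abs_le.1 (hφ 0 1)
  have b5 := abs_le.1 (hφ 1 0)
  have b6 := abs_le.1 (abs_degreeSum_sub_le hφ h)
  -- The increment is at most `8` in absolute value, and the drift at most `(α + γ) + 2 (α + β) + 2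
  -- (β + γ) + 4 β ≤ 8`, so `18` leaves room.
  unfold drift
  rw [abs_le]
  constructor <;> nlinarith

end Step

end DiMultigraph

/-- Time is moved to start at zero. The truncated `k - G₀.numEdges` matters only for `k ≥
G₀.numEdges`. -/
theorem IsPreferentialAttachment.isDiscreteMarkov {Ω : Type*} [MeasurableSpace Ω] {P : Measure Ω}
    {α β γ lam mu : ℝ} {G₀ : DiMultigraph} {G : ℕ → Ω → DiMultigraph}
    (hα : 0 < α) (hβ : 0 < β) (hγ : 0 < γ) (hlam : 0 < lam) (hmu : 0 < mu)
    (hG : IsPreferentialAttachment P α β γ lam mu G₀ G) :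
    IsDiscreteMarkov P (DiMultigraph.stepProb α β γ lam mu) (fun k => G (k + G₀.numEdges)) where
  measurable k := hG.measurable _ (Nat.le_add_left _ _)
  nonneg := DiMultigraph.stepProb_nonneg hα hβ hγ hlam hmu
  markov n g := by
    have h := hG.markov (n + G₀.numEdges) (Nat.le_add_left _ _) fun k => g (k - G₀.numEdges)
    have hset : ∀ m, {ω | ∀ k, G₀.numEdges ≤ k → k ≤ m + G₀.numEdges →
        G k ω = g (k - G₀.numEdges)} = {ω | ∀ k ≤ m, G (k + G₀.numEdges) ω = g k} := by
      intro m
      ext ω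
      refine ⟨fun H k hk => ?_, fun H k hk hkm => ?_⟩
      · simpa using H (k + G₀.numEdges) (Nat.le_add_left _ _) (by omega)
      · have := H (k - G₀.numEdges) (by omega)
        rwa [Nat.sub_add_cancel hk] at this
    rw [show n + G₀.numEdges + 1 = n + 1 + G₀.numEdges by ring, hset, hset, Nat.add_sub_cancel,
      Nat.add_sub_cancel] at h
    exact h

/-! ### Drift of the degree counts. -/

/-- The indicator of in-degree `i` and out-degree `j`. -/
def degreeIndicator (i j a b : ℕ) : ℝ := if a = i ∧ b = j then 1 else 0

theorem abs_degreeIndicator_le (i j a b : ℕ) : |degreeIndicator i j a b| ≤ 1 := by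
  unfold degreeIndicator; split_ifs <;> simp

namespace DiMultigraph

variable (G : DiMultigraph)

theorem degreeSum_degreeIndicator (i j : ℕ) :
    G.degreeSum (degreeIndicator i j) = G.degreeCount i j := by
  simp [degreeSum, degreeIndicator, degreeCount, Finset.sum_boole]

theorem degreeSum_one : G.degreeSum (fun _ _ => 1) = G.numNodes := by
  simp [degreeSum]

variable {lam mu : ℝ}

/-- Against the indicator the weight of a node depends only on `i`: nodes of in-degree `i - 1` enter
and nodes of in-degree `i` leave, all with the same denominator. -/
theorem sum_inChoice_mul_inDiff (i j : ℕ) :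
    ∑ v, inChoice lam G v * G.inDiff (degreeIndicator i j) v =
      (shiftSeq (fun m => (m + lam) * G.degreeCount m j) i - (i + lam) * G.degreeCount i j) /
        (G.numEdges + lam * G.numNodes) := by
  have hterm : ∀ v : Fin G.numNodes, inChoice lam G v * G.inDiff (degreeIndicator i j) v =
      (shiftSeq (fun m => (m + lam) * degreeIndicator m j (G.inDegree v) (G.outDegree v)) i -
        (i + lam) * degreeIndicator i j (G.inDegree v) (G.outDegree v)) /
        (G.numEdges + lam * G.numNodes) := by
    intro v
    rw [inChoice, inDiff, div_mul_eq_mul_div, mul_sub]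
    congr 2
    · cases i with
      | zero => simp [degreeIndicator, shiftSeq]
      | succ m =>
        simp only [degreeIndicator, shiftSeq, Nat.succ_inj]
        split_ifs with h
        · rw [h.1]
        · simp
    · simp only [degreeIndicator]
      split_ifs with h
      · rw [h.1]
      · simp
  have hshift : ∑ v : Fin G.numNodes, shiftSeq (fun m => (m + lam) *
      degreeIndicator m j (G.inDegree v) (G.outDegree v)) i =
      shiftSeq (fun m => (m + lam) * G.degreeCount m j) i := by
    cases i with
    | zero => simp [shiftSeq]
    | succ m => simp only [shiftSeq]; rw [← Finset.mul_sum, ← degreeSum_degreeIndicator, degreeSum]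
  simp only [hterm]
  rw [← Finset.sum_div, Finset.sum_sub_distrib, hshift, ← Finset.mul_sum,
    ← degreeSum_degreeIndicator, degreeSum]

theorem sum_outChoice_mul_outDiff (i j : ℕ) :
    ∑ v, outChoice mu G v * G.outDiff (degreeIndicator i j) v =
      (shiftSeq (fun m => (m + mu) * G.degreeCount i m) j - (j + mu) * G.degreeCount i j) /
        (G.numEdges + mu * G.numNodes) := by
  have hterm : ∀ v : Fin G.numNodes, outChoice mu G v * G.outDiff (degreeIndicator i j) v =
      (shiftSeq (fun m => (m + mu) * degreeIndicator i m (G.inDegree v) (G.outDegree v)) j -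
        (j + mu) * degreeIndicator i j (G.inDegree v) (G.outDegree v)) /
        (G.numEdges + mu * G.numNodes) := by
    intro v
    rw [outChoice, outDiff, div_mul_eq_mul_div, mul_sub]
    congr 2
    · cases j with
      | zero => simp [degreeIndicator, shiftSeq]
      | succ m =>
        simp only [degreeIndicator, shiftSeq, Nat.succ_inj]
        split_ifs with h
        · rw [h.2]
        · simp
    · simp only [degreeIndicator]
      split_ifs with h
      · rw [h.2]
      · simp
  have hshift : ∑ v : Fin G.numNodes, shiftSeq (fun m => (m + mu) *
      degreeIndicator i m (G.inDegree v) (G.outDegree v)) j =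
      shiftSeq (fun m => (m + mu) * G.degreeCount i m) j := by
    cases j with
    | zero => simp [shiftSeq]
    | succ m => simp only [shiftSeq]; rw [← Finset.mul_sum, ← degreeSum_degreeIndicator, degreeSum]
  simp only [hterm]
  rw [← Finset.sum_div, Finset.sum_sub_distrib, hshift, ← Finset.mul_sum,
    ← degreeSum_degreeIndicator, degreeSum]

/-- The mixed difference vanishes unless the degrees are at most `i` and `j`, so each of its two
weights has a bounded numerator; summing over the nodes leaves one uncancelled denominator. -/
theorem abs_sum_mixedDiff_le (hlam : 0 < lam) (hmu : 0 < mu) (i j : ℕ) :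
    |∑ v, outChoice mu G v * inChoice lam G v * G.mixedDiff (degreeIndicator i j) v| ≤
      4 * (i + lam) * (j + mu) * (G.numNodes / (G.numEdges + lam * G.numNodes) *
        (1 / (G.numEdges + mu * G.numNodes))) := by
  have hterm : ∀ v, |outChoice mu G v * inChoice lam G v * G.mixedDiff (degreeIndicator i j) v| ≤
      (j + mu) / (G.numEdges + mu * G.numNodes) *
        ((i + lam) / (G.numEdges + lam * G.numNodes)) * 4 := by
    intro v
    have h1 := inChoice_nonneg G hlam v
    have h2 := outChoice_nonneg G hmu v
    rw [abs_mul, abs_of_nonneg (mul_nonneg h2 h1)]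
    by_cases h : G.inDegree v ≤ i ∧ G.outDegree v ≤ j
    · have hi : (G.inDegree v : ℝ) ≤ i := by exact_mod_cast h.1
      have hj : (G.outDegree v : ℝ) ≤ j := by exact_mod_cast h.2
      have h3 := G.abs_mixedDiff_le (abs_degreeIndicator_le i j) v
      unfold inChoice outChoice
      gcongr
    · have h0 : G.mixedDiff (degreeIndicator i j) v = 0 := by
        simp only [mixedDiff, degreeIndicator]
        rw [if_neg (by omega), if_neg (by omega), if_neg (by omega), if_neg (by omega)]
        simp
      rw [h0, abs_zero, mul_zero]
      positivity
  refine (Finset.abs_sum_le_sum_abs _ _).trans ((Finset.sum_le_sum fun v _ => hterm v).trans ?_)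
  simp only [Finset.sum_const, Finset.card_univ, Fintype.card_fin, nsmul_eq_mul]
  exact le_of_eq (by ring)

end DiMultigraph

/-! ### Long-run behaviour of the degree counts. -/

section LongRun

open DiMultigraph

variable {α β γ lam mu c₁ c₂ : ℝ} {n₀ : ℕ} {Y : ℕ → DiMultigraph}

/-- For constant `φ` all differences vanish, so the drift is exactly `α + γ`. -/
theorem tendsto_numNodes_div
    (hD : Tendsto (fun n : ℕ => (∑ k ∈ Finset.range n, ((Y (k + 1)).degreeSum (fun _ _ => 1) -
      (Y k).degreeSum (fun _ _ => 1) - drift α β γ lam mu (fun _ _ => 1) (Y k))) / n)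
      atTop (𝓝 0)) :
    Tendsto (fun n : ℕ => ((Y n).numNodes : ℝ) / n) atTop (𝓝 (α + γ)) := by
  have hdrift : ∀ G : DiMultigraph, drift α β γ lam mu (fun _ _ => 1) G = α + γ := by
    intro G; simp [drift, inDiff, outDiff, mixedDiff]
  have h := tendsto_div_of_linear_recursion (x := fun n => ((Y n).numNodes : ℝ))
    (A := fun _ => 0) (B := fun _ => α + γ) le_rfl tendsto_const_nhds
    (Eventually.of_forall fun _ => le_rfl) tendsto_const_nhds hD
    (Eventually.of_forall fun n => by simp only [degreeSum_one, hdrift]; ring)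
  simpa using h

theorem tendsto_div_numEdges_add {z : ℝ} (hz : 0 < z) (hα : 0 < α) (hγ : 0 < γ)
    (hedges : ∀ n, (Y n).numEdges = n + n₀)
    (hN : Tendsto (fun n : ℕ => ((Y n).numNodes : ℝ) / n) atTop (𝓝 (α + γ))) :
    Tendsto (fun n : ℕ => (n : ℝ) / ((Y n).numEdges + z * (Y n).numNodes)) atTop
      (𝓝 (1 / (1 + z * (α + γ)))) := by
  have h1 : Tendsto (fun n : ℕ => 1 + (n₀ : ℝ) / n + z * (((Y n).numNodes : ℝ) / n)) atTop
      (𝓝 (1 + 0 + z * (α + γ))) :=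
    (tendsto_const_nhds.add (tendsto_const_div_atTop_nhds_zero_nat _)).add (hN.const_mul z)
  rw [add_zero] at h1
  have h2 := h1.inv₀ (by positivity)
  rw [one_div]
  refine h2.congr' ?_
  filter_upwards [eventually_gt_atTop 0] with n hn
  have hn' : (0 : ℝ) < n := by exact_mod_cast hn
  rw [hedges]
  push_cast
  rw [← inv_div]
  field_simp

/-- The count obeys the deterministic linear recursion: losses form `A`, while the source, the
inflow from preceding degrees and the vanishing loop term `R` form `B`. -/
theorem tendsto_degreeCount_div_step (hα : 0 < α) (hβ : 0 < β) (hγ : 0 < γ) (hlam : 0 < lam)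
    (hmu : 0 < mu) (hc₁ : c₁ = inExponent α β γ lam) (hc₂ : c₂ = outExponent α β γ mu)
    (hedges : ∀ n, (Y n).numEdges = n + n₀)
    (hN : Tendsto (fun n : ℕ => ((Y n).numNodes : ℝ) / n) atTop (𝓝 (α + γ))) (i j : ℕ)
    (hD : Tendsto (fun n : ℕ => (∑ k ∈ Finset.range n,
      ((Y (k + 1)).degreeSum (degreeIndicator i j) - (Y k).degreeSum (degreeIndicator i j) -
        drift α β γ lam mu (degreeIndicator i j) (Y k))) / n) atTop (𝓝 0))
    {s₁ s₂ : ℝ}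
    (h₁ : Tendsto (fun n : ℕ => shiftSeq (fun m => (m + lam) * (Y n).degreeCount m j) i / n)
      atTop (𝓝 s₁))
    (h₂ : Tendsto (fun n : ℕ => shiftSeq (fun m => (m + mu) * (Y n).degreeCount i m) j / n)
      atTop (𝓝 s₂)) :
    Tendsto (fun n : ℕ => ((Y n).degreeCount i j : ℝ) / n) atTop
      (𝓝 ((α * degreeIndicator i j 0 1 + γ * degreeIndicator i j 1 0 + c₁ * s₁ + c₂ * s₂) /
        (1 + (c₁ * (i + lam) + c₂ * (j + mu))))) := by
  have hin := tendsto_div_numEdges_add hlam hα hγ hedges hN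
  have hout := tendsto_div_numEdges_add hmu hα hγ hedges hN
  have e₁ : c₁ = (α + β) * (1 / (1 + lam * (α + γ))) := by rw [hc₁, inExponent]; ring
  have e₂ : c₂ = (β + γ) * (1 / (1 + mu * (α + γ))) := by rw [hc₂, outExponent]; ring
  set R : ℕ → ℝ := fun n => ∑ v, outChoice mu (Y n) v * inChoice lam (Y n) v *
    (Y n).mixedDiff (degreeIndicator i j) v with hR
  have hR0 : Tendsto R atTop (𝓝 0) := by
    have hb : Tendsto (fun n : ℕ => 4 * ((i : ℝ) + lam) * (j + mu) *
        (((Y n).numNodes / ((Y n).numEdges + lam * (Y n).numNodes)) *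
          (1 / ((Y n).numEdges + mu * (Y n).numNodes)))) atTop (𝓝 0) := by
      have h := ((hN.mul hin).mul (hout.mul (tendsto_const_div_atTop_nhds_zero_nat 1))).const_mul
        (4 * ((i : ℝ) + lam) * (j + mu))
      rw [mul_zero, mul_zero, mul_zero] at h
      refine h.congr' ?_
      filter_upwards [eventually_gt_atTop 0] with n hn
      have hn' : (n : ℝ) ≠ 0 := by exact_mod_cast hn.ne'
      field_simp
    exact squeeze_zero_norm (fun n => abs_sum_mixedDiff_le (Y n) hlam hmu i j) hb
  have hA : Tendsto (fun n : ℕ =>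
      (α + β) * ((n : ℝ) / ((Y n).numEdges + lam * (Y n).numNodes)) * (i + lam) +
      (β + γ) * ((n : ℝ) / ((Y n).numEdges + mu * (Y n).numNodes)) * (j + mu)) atTop
      (𝓝 (c₁ * (i + lam) + c₂ * (j + mu))) := by
    rw [e₁, e₂]
    exact ((hin.const_mul _).mul_const _).add ((hout.const_mul _).mul_const _)
  have hB : Tendsto (fun n : ℕ => α * degreeIndicator i j 0 1 + γ * degreeIndicator i j 1 0 +
      (α + β) * ((n : ℝ) / ((Y n).numEdges + lam * (Y n).numNodes)) *
        (shiftSeq (fun m => (m + lam) * (Y n).degreeCount m j) i / n) +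
      (β + γ) * ((n : ℝ) / ((Y n).numEdges + mu * (Y n).numNodes)) *
        (shiftSeq (fun m => (m + mu) * (Y n).degreeCount i m) j / n) + β * R n) atTop
      (𝓝 (α * degreeIndicator i j 0 1 + γ * degreeIndicator i j 1 0 + c₁ * s₁ + c₂ * s₂)) := by
    have h := (((tendsto_const_nhds (x := α * degreeIndicator i j 0 1 +
      γ * degreeIndicator i j 1 0)).add ((hin.const_mul (α + β)).mul h₁)).add
      ((hout.const_mul (β + γ)).mul h₂)).add (hR0.const_mul β)
    rwa [mul_zero, add_zero, ← e₁, ← e₂] at h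
  have hc₁0 : 0 ≤ c₁ := by rw [hc₁, inExponent]; positivity
  have hc₂0 : 0 ≤ c₂ := by rw [hc₂, outExponent]; positivity
  refine tendsto_div_of_linear_recursion (by positivity) hA
    (Eventually.of_forall fun n => by positivity) hB hD ?_
  filter_upwards [eventually_gt_atTop 0] with n hn
  have hn' : (n : ℝ) ≠ 0 := by exact_mod_cast hn.ne'
  simp only [degreeSum_degreeIndicator, drift, sum_inChoice_mul_inDiff, sum_outChoice_mul_outDiff]
  simp only [hR]
  generalize shiftSeq (fun m => (m + lam) * ((Y n).degreeCount m j : ℝ)) i = S₁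
  generalize shiftSeq (fun m => (m + mu) * ((Y n).degreeCount i m : ℝ)) j = S₂
  generalize ((Y n).numEdges + lam * (Y n).numNodes : ℝ) = d₁
  generalize ((Y n).numEdges + mu * (Y n).numNodes : ℝ) = d₂
  have k₁ : ∀ u w : ℝ, (n : ℝ) / w * (u / n) = u / w := fun u w => by field_simp
  have k₂ : ∀ u v w z : ℝ, (z * ((n : ℝ) / w) * v) * (u / n) = z * (v * u / w) :=
    fun u v w z => by field_simp
  rw [add_mul ((α + β) * ((n : ℝ) / d₁) * (i + lam)), k₂, k₂, mul_assoc (α + β), k₁,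
    mul_assoc (β + γ), k₁]
  ring

theorem tendsto_degreeCount_div (hα : 0 < α) (hβ : 0 < β) (hγ : 0 < γ) (hlam : 0 < lam)
    (hmu : 0 < mu) (hc₁ : c₁ = inExponent α β γ lam) (hc₂ : c₂ = outExponent α β γ mu)
    (hedges : ∀ n, (Y n).numEdges = n + n₀)
    (hN : Tendsto (fun n : ℕ => ((Y n).numNodes : ℝ) / n) atTop (𝓝 (α + γ)))
    (hD : ∀ i j, Tendsto (fun n : ℕ => (∑ k ∈ Finset.range n,
      ((Y (k + 1)).degreeSum (degreeIndicator i j) - (Y k).degreeSum (degreeIndicator i j) -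
        drift α β γ lam mu (degreeIndicator i j) (Y k))) / n) atTop (𝓝 0)) (i j : ℕ) :
    Tendsto (fun n : ℕ => ((Y n).degreeCount i j : ℝ) / n) atTop
      (𝓝 ((α + γ) * degreeLaw α γ lam mu c₁ c₂ i j)) := by
  have hc₁0 : 0 < c₁ := by rw [hc₁, inExponent]; positivity
  have hc₂0 : 0 < c₂ := by rw [hc₂, outExponent]; positivity
  -- The induction step assumes the limit only at the existing predecessors; on the boundary the
  -- corresponding shift is zero.
  have step : ∀ i j,
      (∀ m, i = m + 1 → Tendsto (fun n : ℕ => ((Y n).degreeCount m j : ℝ) / n) atTop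
        (𝓝 ((α + γ) * degreeLaw α γ lam mu c₁ c₂ m j))) →
      (∀ m, j = m + 1 → Tendsto (fun n : ℕ => ((Y n).degreeCount i m : ℝ) / n) atTop
        (𝓝 ((α + γ) * degreeLaw α γ lam mu c₁ c₂ i m))) →
      Tendsto (fun n : ℕ => ((Y n).degreeCount i j : ℝ) / n) atTop
        (𝓝 ((α + γ) * degreeLaw α γ lam mu c₁ c₂ i j)) := by
    intro i j hi hj
    have h₁ : Tendsto (fun n : ℕ => shiftSeq (fun m => (m + lam) * (Y n).degreeCount m j) i / n)
        atTop (𝓝 ((α + γ) * shiftSeq (fun m => (m + lam) * degreeLaw α γ lam mu c₁ c₂ m j) i)) := by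
      cases i with
      | zero => simp [shiftSeq]
      | succ m =>
        simp only [shiftSeq, mul_div_assoc]
        rw [mul_left_comm]
        exact (hi m rfl).const_mul _
    have h₂ : Tendsto (fun n : ℕ => shiftSeq (fun m => (m + mu) * (Y n).degreeCount i m) j / n)
        atTop (𝓝 ((α + γ) * shiftSeq (fun m => (m + mu) * degreeLaw α γ lam mu c₁ c₂ i m) j)) := by
      cases j with
      | zero => simp [shiftSeq]
      | succ m =>
        simp only [shiftSeq, mul_div_assoc]
        rw [mul_left_comm]
        exact (hj m rfl).const_mul _
    have h := tendsto_degreeCount_div_step hα hβ hγ hlam hmu hc₁ hc₂ hedges hN i j (hD i j) h₁ h₂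
    convert! h using 2
    have hrec := degreeLaw_recursion (α := α) (γ := γ) hlam hmu hc₁0 hc₂0 i j
    have hαγ : α + γ ≠ 0 := by positivity
    have i1 : degreeIndicator i j 1 0 = if i = 1 ∧ j = 0 then 1 else 0 := by
      simp only [degreeIndicator, eq_comm]
    have i2 : degreeIndicator i j 0 1 = if i = 0 ∧ j = 1 then 1 else 0 := by
      simp only [degreeIndicator, eq_comm]
    rw [← i1, ← i2] at hrec
    rw [eq_div_iff (by positivity)]
    have k₁ : (α + γ) * (γ / (α + γ)) = γ := by field_simp
    have k₂ : (α + γ) * (α / (α + γ)) = α := by field_simp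
    linear_combination (α + γ) * hrec + degreeIndicator i j 1 0 * k₁ + degreeIndicator i j 0 1 * k₂
  induction i generalizing j with
  | zero =>
    induction j with
    | zero => exact step 0 0 (fun m h => by omega) fun m h => by omega
    | succ j ih =>
      exact step 0 (j + 1) (fun m h => by omega) fun m h => by
        obtain rfl : j = m := by omega
        exact ih
  | succ i ihi =>
    have hstep : ∀ m, i + 1 = m + 1 → ∀ j, Tendsto (fun n : ℕ => ((Y n).degreeCount m j : ℝ) / n)
        atTop (𝓝 ((α + γ) * degreeLaw α γ lam mu c₁ c₂ m j)) := by
      intro m h j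
      obtain rfl : i = m := by omega
      exact ihi j
    induction j with
    | zero => exact step (i + 1) 0 (fun m h => hstep m h 0) fun m h => by omega
    | succ j ih =>
      exact step (i + 1) (j + 1) (fun m h => hstep m h (j + 1)) fun m h => by
        obtain rfl : j = m := by omega
        exact ih

end LongRun

theorem IsPreferentialAttachment.ae_tendsto_degreeCount_div {Ω : Type*} [MeasurableSpace Ω]
    {P : Measure Ω} [IsProbabilityMeasure P] {α β γ lam mu c₁ c₂ : ℝ} {G₀ : DiMultigraph}
    {G : ℕ → Ω → DiMultigraph} (hα : 0 < α) (hβ : 0 < β) (hγ : 0 < γ) (hlam : 0 < lam)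
    (hmu : 0 < mu) (hsum : α + β + γ = 1) (hc₁ : c₁ = inExponent α β γ lam)
    (hc₂ : c₂ = outExponent α β γ mu) (hG : IsPreferentialAttachment P α β γ lam mu G₀ G) :
    ∀ᵐ ω ∂P, ∀ i j, Tendsto (fun n : ℕ => ((G n ω).degreeCount i j : ℝ) / ((G n ω).numNodes : ℝ))
      atTop (𝓝 (degreeLaw α γ lam mu c₁ c₂ i j)) := by
  have hX := hG.isDiscreteMarkov hα hβ hγ hlam hmu
  have hlaw : ∀ φ : ℕ → ℕ → ℝ, (∀ a b, |φ a b| ≤ 1) → ∀ᵐ ω ∂P, Tendsto (fun n : ℕ =>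
      (∑ k ∈ Finset.range n, ((G (k + 1 + G₀.numEdges) ω).degreeSum φ -
        (G (k + G₀.numEdges) ω).degreeSum φ -
        DiMultigraph.drift α β γ lam mu φ (G (k + G₀.numEdges) ω))) / n) atTop (𝓝 0) :=
    fun φ hφ => hX.ae_tendsto_sum_div
      (ψ := fun G G' => G'.degreeSum φ - G.degreeSum φ - DiMultigraph.drift α β γ lam mu φ G)
      (DiMultigraph.abs_centered_le hα hβ hγ hlam hmu hsum hφ)
      (DiMultigraph.hasSum_stepProb_centered hlam hmu hsum φ)
  have hind : ∀ᵐ ω ∂P, ∀ i j, Tendsto (fun n : ℕ =>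
      (∑ k ∈ Finset.range n, ((G (k + 1 + G₀.numEdges) ω).degreeSum (degreeIndicator i j) -
        (G (k + G₀.numEdges) ω).degreeSum (degreeIndicator i j) -
        DiMultigraph.drift α β γ lam mu (degreeIndicator i j) (G (k + G₀.numEdges) ω))) / n)
      atTop (𝓝 0) :=
    ae_all_iff.2 fun i => ae_all_iff.2 fun j => hlaw _ (abs_degreeIndicator_le i j)
  filter_upwards [hG.initial, hX.ae_transition_pos, hlaw (fun _ _ => 1) (fun _ _ => by simp), hind]
    with ω h0 htrans hnodes hdeg i j
  have hedges : ∀ n, (G (n + G₀.numEdges) ω).numEdges = n + G₀.numEdges := by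
    intro n
    induction n with
    | zero => rw [Nat.zero_add, h0]
    | succ n ih => rw [DiMultigraph.numEdges_of_stepProb_pos (htrans n), ih]; ring
  have hN := tendsto_numNodes_div (Y := fun n => G (n + G₀.numEdges) ω) hnodes
  have hij := tendsto_degreeCount_div (Y := fun n => G (n + G₀.numEdges) ω) hα hβ hγ hlam hmu
    hc₁ hc₂ hedges hN hdeg i j
  -- The clock is moved back by `n₀`; then `N_ij` and `N`, both divided by `n`, are compared.
  rw [← tendsto_add_atTop_iff_nat G₀.numEdges]
  have hαγ : α + γ ≠ 0 := by positivity
  have h := hij.div hN hαγ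
  rw [mul_div_cancel_left₀ _ hαγ] at h
  refine h.congr' ?_
  filter_upwards [eventually_gt_atTop 0] with n hn
  have hn' : (n : ℝ) ≠ 0 := by exact_mod_cast hn.ne'
  exact div_div_div_cancel_right₀ hn' _ _

end

/-! ### The theorem. -/

theorem mainTheorem7 (α β γ lam mu c₁ c₂ : ℝ)
    (hα : 0 < α) (hβ : 0 < β) (hγ : 0 < γ) (hlam : 0 < lam) (hmu : 0 < mu)
    (hsum : α + β + γ = 1)
    (hc₁ : c₁ = inExponent α β γ lam) (hc₂ : c₂ = outExponent α β γ mu) (hne : c₁ ≠ c₂) :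
    ∃ p : ℕ → ℕ → ℝ,
      -- `p` is the almost sure limit of the proportions of nodes of given in- and out-degree
      (∀ (Ω : Type*) [MeasurableSpace Ω] (P : Measure Ω) [IsProbabilityMeasure P]
        (G₀ : DiMultigraph) (G : ℕ → Ω → DiMultigraph), 0 < G₀.numNodes →
        IsPreferentialAttachment P α β γ lam mu G₀ G →
        ∀ i j, ∀ᵐ ω ∂P,
          Tendsto (fun n : ℕ => ((G n ω).degreeCount i j : ℝ) / ((G n ω).numNodes : ℝ))
            atTop (𝓝 (p i j))) ∧
      -- `p` is a probability mass function
      (∀ i j, 0 ≤ p i j) ∧ HasSum (fun ij : ℕ × ℕ => p ij.1 ij.2) 1 ∧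
      -- `p` is regularly varying and embeddable
      IsRegVarDiscrete p (fun t => t ^ c₁) (fun t => t ^ c₂) (limitDensity α γ lam mu c₁ c₂) ∧
      IsEmbeddable p (fun t => t ^ c₁) (fun t => t ^ c₂) (limitDensity α γ lam mu c₁ c₂) ∧
      -- the explicit limit, with convergent integrals
      (∀ x y : ℝ, 0 < x → 0 < y →
        IntegrableOn (mixIntegrand (2 + 1 / c₁ + lam + c₂ / c₁ * mu) (c₂ / c₁) x y) (Ioi 0) ∧
        IntegrableOn (mixIntegrand (1 + c₂ / c₁ + 1 / c₁ + lam + c₂ / c₁ * mu) (c₂ / c₁) x y)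
          (Ioi 0) ∧
        Tendsto (fun n : ℕ =>
            p ⌊(n : ℝ) ^ c₁ * x⌋₊ ⌊(n : ℝ) ^ c₂ * y⌋₊ / (n : ℝ) ^ (-(1 + c₁ + c₂)))
          atTop (𝓝 (limitDensity α γ lam mu c₁ c₂ x y))) ∧
      -- uniformity on compact sets not containing the origin, and avoiding each axis on which
      -- the limit function blows up
      (∀ K : Set (ℝ × ℝ), IsCompact K → K ⊆ Ici 0 ×ˢ Ici 0 → (0, 0) ∉ K →
        (lam < 1 → ∀ v ∈ K, 0 < v.1) → (mu < 1 → ∀ v ∈ K, 0 < v.2) →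
        TendstoUniformlyOn (fun (t : ℝ) (v : ℝ × ℝ) =>
            p ⌊t ^ c₁ * v.1⌋₊ ⌊t ^ c₂ * v.2⌋₊ / t ^ (-(1 + c₁ + c₂)))
          (fun v => limitDensity α γ lam mu c₁ c₂ v.1 v.2) atTop K) ∧
      -- uniformity on the whole deformed unit sphere, end points included
      (1 ≤ lam → 1 ≤ mu → ∀ ν : Seminorm ℝ (ℝ × ℝ), (∀ v, ν v = 0 → v = 0) →
        TendstoUniformlyOn (fun (t : ℝ) (v : ℝ × ℝ) =>
            p ⌊t ^ c₁ * v.1⌋₊ ⌊t ^ c₂ * v.2⌋₊ / t ^ (-(1 + c₁ + c₂)))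
          (fun v => limitDensity α γ lam mu c₁ c₂ v.1 v.2) atTop
          (deformedSphere ν c₁ c₂)) := by
  have hc₁0 : 0 < c₁ := by rw [hc₁, inExponent]; positivity
  have hc₂0 : 0 < c₂ := by rw [hc₂, outExponent]; positivity
  refine ⟨degreeLaw α γ lam mu c₁ c₂, ?_, degreeLaw_nonneg hα hγ hlam hmu hc₁0 hc₂0,
    hasSum_degreeLaw hα hγ hlam hmu hc₁0 hc₂0,
    isRegVarDiscrete_degreeLaw hα hγ hlam hmu hc₁0 hc₂0,
    isEmbeddable_degreeLaw hα hγ hlam hmu hc₁0 hc₂0, ?_,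
    fun K hK hK0 h0 hl hm => tendstoUniformlyOn_degreeLaw hlam hmu hc₁0 hc₂0 hK hK0 h0 hl hm, ?_⟩
  · intro Ω _ P _ G₀ G _ hG i j
    exact (hG.ae_tendsto_degreeCount_div hα hβ hγ hlam hmu hsum hc₁ hc₂).mono fun ω h => h i j
  · intro x y hx hy
    have e1 : 2 + 1 / c₁ + lam + c₂ / c₁ * mu = 1 + (1 + c₁ * (lam + 1) + c₂ * mu) / c₁ := by
      field_simp; ring
    have e2 : 1 + c₂ / c₁ + 1 / c₁ + lam + c₂ / c₁ * mu =
        1 + (1 + c₂ * (mu + 1) + c₁ * lam) / c₁ := by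
      field_simp; ring
    rw [e1, e2]
    exact ⟨integrableOn_mixIntegrand (by positivity) hc₁0 hc₂0 hx.le hy.le (Or.inl hx),
      integrableOn_mixIntegrand (by positivity) hc₁0 hc₂0 hx.le hy.le (Or.inl hx),
      (tendsto_degreeLaw_real hlam hmu hc₁0 hc₂0 hx hy).comp tendsto_natCast_atTop_atTop⟩
  · intro hl hm ν hν
    -- Only inclusion in a compact set avoiding the origin is needed; for `lam, mu ≥ 1` the
    -- conditions on the axes are vacuous.
    obtain ⟨K, hK, hK0, h0, hsub⟩ := exists_isCompact_deformedSphere_subset ν hν hc₁0 hc₂0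
    exact (tendstoUniformlyOn_degreeLaw hlam hmu hc₁0 hc₂0 hK hK0 h0 (fun h => absurd h hl.not_gt)
      fun h => absurd h hm.not_gt).mono hsub
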